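/- Let $n\ge 4$, let $X=\{F=0\}\subset\mathbb P^n$ be a smooth cubic hypersurface over $\mathbb C$, and let $p\in X$ be an Eckardt point, i.e. the tangent hyperplane $T_pX\cong\mathbb P^{n-1}$ intersects $X$ at $p$ with multiplicity $3$. Let $\Lambda\cong\mathbb P^{n-2}$ be a hyperplane of $T_pX$ not containing $p$, with homogeneous coordinates $y_1,\dots,y_{n-1}$, let $Y=X\cap \Lambda$, with equation $G=F|_\Lambda$, and let $\mathrm{Hess}(Y)\subset\Lambda$ be the Hessian hypersurface $\det\left(\frac{\partial^2 G}{\partial y_i\partial y_j}\right)=0$. A line $L\subset X$ is of the second type if there is a linear subspace $P^{n-2}\subset\mathbb P^n$ of codimension two containing $L$ and tangent to $X$ at all points of $L$. It is a higher triple line if it is of the second type and, in linear coordinates in which $L=\{x_2=\dots=x_n=0\}$ and $$F=x_2x_0^2+x_3x_1^2+\sum_{2\le i,j\le n}x_ix_jL_{ij}(x_0,x_1)+C(x_2,\dots,x_n)$$ with linear forms $L_{ij}=L_{ji}$ and a cubic form $C$, the columns of the matrix $(L_{ij})_{4\le i,j\le n}$ are linearly dependent over $\mathbb C$. Then $Y$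 is a smooth cubic hypersurface in $\Lambda$, $T_pX\cap X$ is the cone over $Y$ with vertex $p$, and the higher triple lines on $X$ passing through $p$ are parametrized by $Y\cap \mathrm{Hess}(Y)$: the map $q\mapsto\overline{pq}$ is a bijection from $Y\cap\mathrm{Hess}(Y)$ onto the set of higher triple lines on $X$ through $p$, and it is an isomorphism of projective algebraic sets (taken with reduced structure) onto this set, viewed as a closed subset of the Grassmannian $Gr(2,n+1)$ in its Plücker embedding. In particular, the family of higher triple lines on $X$ through $p$ has dimension $n-4$. -/

import Mathlib

open MvPolynomial Module
open scoped LinearAlgebra.Projectivization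

noncomputable section

namespace CubicLines

variable {ι κ : Type*} [Fintype ι] [Fintype κ]

/-! ### Projective algebraic sets -/

/-- The hypersurface of projective space defined by a (homogeneous) polynomial. -/
def hypersurface (F : MvPolynomial ι ℂ) : Set (ℙ ℂ (ι → ℂ)) :=
  {x | eval x.rep F = 0}

/-- Zariski closed subsets of projective space: common zeros of homogeneous polynomials. -/
def IsZariskiClosed (Z : Set (ℙ ℂ (ι → ℂ))) : Prop :=
  ∃ S : Set (MvPolynomial ι ℂ), (∀ f ∈ S, ∃ d : ℕ, f.IsHomogeneous d) ∧
    Z = {x | ∀ f ∈ S, eval x.rep f = 0}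

/-- The affine cone over a subset of projective space. -/
def affineCone (Z : Set (ℙ ℂ (ι → ℂ))) : Set (ι → ℂ) :=
  {v | ∃ z ∈ Z, v ∈ z.submodule}

/-- The homogeneous coordinate ring of a subset of projective space: polynomials modulo those
vanishing on the affine cone. -/
abbrev CoordRing (Z : Set (ℙ ℂ (ι → ℂ))) : Type _ :=
  MvPolynomial ι ℂ ⧸ MvPolynomial.vanishingIdeal ℂ (affineCone Z)

/-- A projective algebraic set has dimension `d` if it is Zariski closed and its homogeneous
coordinate ring has Krull dimension `d + 1`. (The empty set has no dimension: its coordinate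
ring is zero, of Krull dimension `⊥`.) -/
def HasProjDim (Z : Set (ℙ ℂ (ι → ℂ))) (d : ℕ) : Prop :=
  IsZariskiClosed Z ∧ ringKrullDim (CoordRing Z) = ((d + 1 : ℕ) : WithBot ℕ∞)

/-- Regular maps between subsets of projective spaces: near every point, the map is
`y ↦ [P₁(y) : P₂(y) : ...]` for homogeneous polynomials of one common degree. -/
def IsRegularMap {Z : Set (ℙ ℂ (ι → ℂ))} {Z' : Set (ℙ ℂ (κ → ℂ))} (φ : Z → Z') : Prop :=
  ∀ x : Z, ∃ (d : ℕ) (P : κ → MvPolynomial ι ℂ),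
    (∀ k, (P k).IsHomogeneous d) ∧
    (∃ k, eval x.1.rep (P k) ≠ 0) ∧
    ∀ y : Z, (∃ k, eval y.1.rep (P k) ≠ 0) →
      (φ y).1.submodule = Submodule.span ℂ {fun k => eval y.1.rep (P k)}

/-! ### Hypersurfaces -/

/-- The hypersurface `F = 0` is smooth: no nonzero vector is a common zero of `F` and its
partial derivatives. -/
def IsSmoothForm (F : MvPolynomial ι ℂ) : Prop :=
  ∀ x : ι → ℂ, x ≠ 0 → eval x F = 0 → ∃ i, eval x (pderiv i F) ≠ 0

/-- The linear subspace `{w | ∑ i, w i * ∂F/∂xᵢ(x) = 0}` of the ambient vector space: at a smooth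
point `x` of the hypersurface, its projectivization is the projective tangent hyperplane. -/
def tangentSpace (F : MvPolynomial ι ℂ) (x : ι → ℂ) : Submodule ℂ (ι → ℂ) :=
  LinearMap.ker (Fintype.linearCombination ℂ (fun i => eval x (pderiv i F)))

/-- The form `F (∑ k, y k • b k)` in the variables `y`: the expression of `F` in new coordinates
if `b` is a basis, and the restriction of `F` to the span of `b` if `b` is independent. -/
def pullback (b : κ → ι → ℂ) (F : MvPolynomial ι ℂ) : MvPolynomial κ ℂ :=
  aeval (fun i => ∑ k, C (b k i) * X k) F

/-- The polynomial `F (p + t w)` in the variable `t`. -/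
def alongLine (F : MvPolynomial ι ℂ) (p w : ι → ℂ) : Polynomial ℂ :=
  aeval (fun i => Polynomial.C (p i) + Polynomial.C (w i) * Polynomial.X) F

/-- The hypersurface cut out by `F = 0` in the projectivization of the linear subspace `T` has
multiplicity exactly `m` at the point `p`: the minimal order of vanishing at `p` of `F` along the
lines of `T` through `p` is `m`. -/
def HasMultiplicityOn (F : MvPolynomial ι ℂ) (T : Submodule ℂ (ι → ℂ)) (p : ι → ℂ) (m : ℕ) :
    Prop :=
  p ∈ T ∧ (∀ w ∈ T, Polynomial.X ^ m ∣ alongLine F p w) ∧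
    ∃ w ∈ T, ¬ Polynomial.X ^ (m + 1) ∣ alongLine F p w

/-- `p` is an Eckardt point of the hypersurface `F = 0`: the tangent hyperplane at `p` intersects
the hypersurface at `p` with multiplicity `3`. -/
def IsEckardtPoint (F : MvPolynomial ι ℂ) (p : ℙ ℂ (ι → ℂ)) : Prop :=
  p ∈ hypersurface F ∧ HasMultiplicityOn F (tangentSpace F p.rep) p.rep 3

/-- The Hessian determinant of `G`. -/
def hessianDet [DecidableEq ι] (G : MvPolynomial ι ℂ) : MvPolynomial ι ℂ :=
  (Matrix.of fun i j => pderiv i (pderiv j G)).det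

/-! ### Lines in `ℙⁿ`, as two-dimensional subspaces of `ℂⁿ⁺¹` -/

/-- The two-dimensional subspace `L` is a line contained in the hypersurface `F = 0`. -/
def IsLineIn (F : MvPolynomial ι ℂ) (L : Submodule ℂ (ι → ℂ)) : Prop :=
  finrank ℂ L = 2 ∧ ∀ x ∈ L, eval x F = 0

/-- Lines of the second type on a hypersurface in `ℙⁿ`: some linear subspace of codimension two
(vector space dimension `n - 1`) contains `L` and is tangent to the hypersurface at every point
of `L`. -/
def IsSecondType {n : ℕ} (F : MvPolynomial (Fin (n + 1)) ℂ)
    (L : Submodule ℂ (Fin (n + 1) → ℂ)) : Prop :=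
  IsLineIn F L ∧ ∃ P : Submodule ℂ (Fin (n + 1) → ℂ),
    finrank ℂ P = n - 1 ∧ L ≤ P ∧ ∀ x ∈ L, P ≤ tangentSpace F x

/-- Higher triple lines (for `4 ≤ n`): `L` is of the second type, and in linear coordinates
`x₀, …, xₙ` in which `L` is `x₂ = ⋯ = xₙ = 0` and the cubic has the form
`x₂ x₀² + x₃ x₁² + ∑_{2 ≤ i, j ≤ n} xᵢ xⱼ Lᵢⱼ(x₀, x₁) + K(x₂, …, xₙ)`, with `Lᵢⱼ = Lⱼᵢ` linear
forms and `K` a cubic form, the columns of the matrix `(Lᵢⱼ)`, `4 ≤ i, j ≤ n`, are linearly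
dependent over `ℂ`. -/
def IsHigherTripleLine {n : ℕ} (F : MvPolynomial (Fin (n + 1)) ℂ)
    (L : Submodule ℂ (Fin (n + 1) → ℂ)) : Prop :=
  IsSecondType F L ∧
    ∃ (e : Basis (Fin (n + 1)) ℂ (Fin (n + 1) → ℂ))
      (ℓ : Fin (n + 1) → Fin (n + 1) → MvPolynomial (Fin (n + 1)) ℂ)
      (K : MvPolynomial (Fin (n + 1)) ℂ),
      L = Submodule.span ℂ {e 0, e 1} ∧
      (∀ i j, ℓ i j = ℓ j i ∧ (ℓ i j).IsHomogeneous 1 ∧ ℓ i j ∈ supported ℂ {0, 1}) ∧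
      K.IsHomogeneous 3 ∧ K ∈ supported ℂ (Set.Ici 2) ∧
      pullback (fun k => e k) F = X 2 * X 0 ^ 2 + X 3 * X 1 ^ 2 +
        (∑ i ∈ Finset.Ici (2 : Fin (n + 1)), ∑ j ∈ Finset.Ici (2 : Fin (n + 1)),
          X i * X j * ℓ i j) + K ∧
      ¬ LinearIndependent ℂ
        (fun j : Set.Ici (4 : Fin (n + 1)) => fun i : Set.Ici (4 : Fin (n + 1)) => ℓ i j)

/-- The higher triple lines on `F = 0` through the point `p`. -/
def higherTripleLinesThrough {n : ℕ} (F : MvPolynomial (Fin (n + 1)) ℂ)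
    (p : ℙ ℂ (Fin (n + 1) → ℂ)) : Set (Submodule ℂ (Fin (n + 1) → ℂ)) :=
  {L | IsHigherTripleLine F L ∧ p.submodule ≤ L}

/-- The line joining `p` to the point with homogeneous coordinates `q` with respect to the
independent vectors `b`. -/
def joinLine (p : ℙ ℂ (ι → ℂ)) (b : κ → ι → ℂ) (q : ℙ ℂ (κ → ℂ)) : Submodule ℂ (ι → ℂ) :=
  p.submodule ⊔ q.submodule.map (Fintype.linearCombination ℂ b)

/-- The Plücker coordinates `uᵢ vⱼ - uⱼ vᵢ` of a pair of vectors. -/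
def wedge (u v : ι → ℂ) : ι × ι → ℂ := fun ij => u ij.1 * v ij.2 - u ij.2 * v ij.1

/-- `z` is the Plücker point of the line `L`. -/
def IsPluckerPoint (L : Submodule ℂ (ι → ℂ)) (z : ℙ ℂ (ι × ι → ℂ)) : Prop :=
  z.submodule = Submodule.span ℂ {ω | ∃ u ∈ L, ∃ v ∈ L, ω = wedge u v}

/-- The subset of the Plücker-embedded Grassmannian corresponding to a set of lines. -/
def pluckerSet (𝓛 : Set (Submodule ℂ (ι → ℂ))) : Set (ℙ ℂ (ι × ι → ℂ)) :=
  {z | ∃ L ∈ 𝓛, IsPluckerPoint L z}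

end CubicLines

end

open CubicLines

noncomputable section

namespace CubicLines

variable {ι κ : Type*} [Fintype ι] [Fintype κ]

/-! ### The symmetric trilinear form of a cubic -/

/-! Let Φ = `polar F` be the symmetric trilinear form with Φ(x,x,x) = F(x); the tangent space at x
is the kernel of Φ(x,x,·). Let T be the tangent space at p and s the inclusion of Λ in coordinates.
The Eckardt condition makes Φ(p,v,w) vanish for v, w in T, so on T = ℂp ⊕ im s the form Φ does not
see p: it is Φ_G composed with the projection from p (`polar_combination`). Hence the section by T
is a cone over Y. If y were singular on Y, a suitable point tp + s(y) would be singular on X, so Y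
is smooth.

The lines of X through p are the spans ⟨p, s(y)⟩ with G(y) = 0. The condition on columns is made
free of coordinates in `IsDegenerateAlong`: if P is the space of vectors tangent to X along L, given
by x₂ = x₃ = 0 in the normal form, then the matrix (Lᵢⱼ) with i, j ≥ 4 represents the quadratic
forms Φ(u,·,·), u ∈ L, on P/L, and a relation between its columns is a common kernel vector. For L =
⟨p, s(y)⟩ these forms reduce to multiples of Φ_G(y,·,·) on the tangent space of Y at y modulo y.
Since Φ_G(y,y,·) ≠ 0, this degenerates exactly when Φ_G(y,·,·) degenerates on the whole space, that
is, when the Hessian determinant vanishes at y (`isDegenerateAlong_iff`,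
`eval_hessianDet_eq_zero_iff`). Conversely, a suitable basis puts F in normal form along such a line
(`isHigherTripleLine`).

The Plücker point of the line is p ∧ s(q), linear and injective in q, so the bijection is induced by
a linear embedding of projective spaces. This gives the isomorphism and preserves dimension. The
dimension of Y ∩ Hess(Y) follows from Krull's height theorem once no prime factor of G divides the
Hessian determinant (`hessianDet_notMem_span_of_prime_dvd`). The latter holds because the partial
derivatives of G have no common zero but 0, so the polynomial ring is finite over the algebra they
generate, and a derivation killing that algebra must vanish. -/

/-- The trilinear form with coefficients the third partial derivatives of `F`, divided by six. -/
def polar (F : MvPolynomial ι ℂ) : (ι → ℂ) →ₗ[ℂ] (ι → ℂ) →ₗ[ℂ] (ι → ℂ) →ₗ[ℂ] ℂ :=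
  ∑ i, (LinearMap.proj i).smulRight (∑ j, (LinearMap.proj j).smulRight
    (∑ k, (coeff 0 (pderiv i (pderiv j (pderiv k F))) / 6) • LinearMap.proj k))

theorem polar_apply (F : MvPolynomial ι ℂ) (x y z : ι → ℂ) :
    polar F x y z =
      ∑ i, ∑ j, ∑ k, x i * y j * z k * (coeff 0 (pderiv i (pderiv j (pderiv k F))) / 6) := by
  simp only [polar, LinearMap.sum_apply, LinearMap.smulRight_apply, LinearMap.proj_apply,
    LinearMap.smul_apply, smul_eq_mul, Finset.mul_sum]
  refine Finset.sum_congr rfl fun i _ => Finset.sum_congr rfl fun j _ =>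
    Finset.sum_congr rfl fun k _ => by ring

omit [Fintype ι] in
theorem pderiv_comm (F : MvPolynomial ι ℂ) (i j : ι) :
    pderiv i (pderiv j F) = pderiv j (pderiv i F) := by
  classical
  have h : ⁅(pderiv i : Derivation ℂ (MvPolynomial ι ℂ) (MvPolynomial ι ℂ)), pderiv j⁆ =
      (0 : Derivation ℂ (MvPolynomial ι ℂ) (MvPolynomial ι ℂ)) := by
    refine MvPolynomial.derivation_ext (R := ℂ) fun k => ?_
    simp only [Derivation.commutator_apply, pderiv_X, Pi.single_apply, Derivation.coe_zero,
      Pi.zero_apply]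
    split_ifs <;> simp
  have := congrArg (fun D : Derivation ℂ (MvPolynomial ι ℂ) (MvPolynomial ι ℂ) => D F) h
  simpa [Derivation.commutator_apply, sub_eq_zero] using this

theorem polar_swap_left (F : MvPolynomial ι ℂ) (x y z : ι → ℂ) :
    polar F x y z = polar F y x z := by
  rw [polar_apply, polar_apply, Finset.sum_comm]
  refine Finset.sum_congr rfl fun i _ => Finset.sum_congr rfl fun j _ =>
    Finset.sum_congr rfl fun k _ => ?_
  rw [pderiv_comm _ j i]
  ring

theorem polar_swap_right (F : MvPolynomial ι ℂ) (x y z : ι → ℂ) :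
    polar F x y z = polar F x z y := by
  rw [polar_apply, polar_apply]
  refine Finset.sum_congr rfl fun i _ => ?_
  rw [Finset.sum_comm]
  refine Finset.sum_congr rfl fun j _ => Finset.sum_congr rfl fun k _ => ?_
  rw [pderiv_comm _ k j]
  ring

theorem eval_euler {F : MvPolynomial ι ℂ} {d : ℕ} (hF : F.IsHomogeneous d) (x : ι → ℂ) :
    ∑ i, x i * eval x (pderiv i F) = d * eval x F := by
  have := congrArg (eval x) hF.sum_X_mul_pderiv
  simpa [map_sum] using this

theorem polar_single_single [DecidableEq ι] {F : MvPolynomial ι ℂ} (hF : F.IsHomogeneous 3)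
    (x : ι → ℂ) (j k : ι) :
    polar F x (Pi.single j 1) (Pi.single k 1) = eval x (pderiv j (pderiv k F)) / 6 := by
  have h2 := eval_euler ((hF.pderiv (i := k)).pderiv (i := j)) x
  rw [polar_apply]
  simp only [Pi.single_apply, mul_ite, mul_one, mul_zero, ite_mul, zero_mul,
    Finset.sum_ite_eq', Finset.mem_univ, if_true]
  -- The third partials of a cubic are constants, so Euler's identity for the linear form ∂ⱼ∂ₖF has
  -- the coefficients of `polar` in it.
  have h3 : ∀ i, eval x (pderiv i (pderiv j (pderiv k F))) =
      coeff 0 (pderiv i (pderiv j (pderiv k F))) := fun i => by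
    have h0 := ((hF.pderiv (i := k)).pderiv (i := j)).pderiv (i := i)
    rw [totalDegree_eq_zero_iff_eq_C.1 (h0.totalDegree_le.antisymm (Nat.zero_le _))]
    simp
  simp only [h3] at h2
  rw [← Finset.sum_congr rfl fun i _ => mul_div_assoc _ _ _, ← Finset.sum_div, h2]
  norm_num

theorem polar_self_single [DecidableEq ι] {F : MvPolynomial ι ℂ} (hF : F.IsHomogeneous 3)
    (x : ι → ℂ) (k : ι) :
    polar F x x (Pi.single k 1) = eval x (pderiv k F) / 3 := by
  have h2 := eval_euler (hF.pderiv (i := k)) x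
  have hx : polar F x x (Pi.single k 1) =
      ∑ j, x j * polar F x (Pi.single j 1) (Pi.single k 1) := by
    conv_lhs => rw [← Finset.univ_sum_single x]
    rw [map_sum (polar F (∑ i, Pi.single i (x i))), LinearMap.sum_apply, Finset.univ_sum_single]
    refine Finset.sum_congr rfl fun j _ => ?_
    rw [show (Pi.single j (x j) : ι → ℂ) = x j • Pi.single j 1 by
      rw [← Pi.single_smul, smul_eq_mul, mul_one]]
    simp
  rw [hx]
  simp only [polar_single_single hF]
  rw [← Finset.sum_congr rfl fun i _ => mul_div_assoc _ _ _, ← Finset.sum_div, h2]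
  norm_num
  ring

theorem polar_self_left {F : MvPolynomial ι ℂ} (hF : F.IsHomogeneous 3) (x w : ι → ℂ) :
    polar F x x w = (∑ i, w i * eval x (pderiv i F)) / 3 := by
  classical
  conv_lhs => rw [← Finset.univ_sum_single w]
  rw [map_sum, Finset.sum_div]
  refine Finset.sum_congr rfl fun j _ => ?_
  rw [show (Pi.single j (w j) : ι → ℂ) = w j • Pi.single j 1 by
      rw [← Pi.single_smul, smul_eq_mul, mul_one], map_smul, polar_self_single hF, smul_eq_mul,
      mul_div_assoc]

theorem eval_eq_polar {F : MvPolynomial ι ℂ} (hF : F.IsHomogeneous 3) (x : ι → ℂ) :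
    eval x F = polar F x x x := by
  rw [polar_self_left hF, eval_euler hF]
  norm_num

theorem mem_tangentSpace {F : MvPolynomial ι ℂ} (hF : F.IsHomogeneous 3) {x w : ι → ℂ} :
    w ∈ tangentSpace F x ↔ polar F x x w = 0 := by
  rw [tangentSpace, LinearMap.mem_ker, Fintype.linearCombination_apply, polar_self_left hF]
  simp

theorem tangentSpace_eq_ker {F : MvPolynomial ι ℂ} (hF : F.IsHomogeneous 3) (x : ι → ℂ) :
    tangentSpace F x = LinearMap.ker (polar F x x) := by
  ext w
  rw [mem_tangentSpace hF, LinearMap.mem_ker]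

/-- By Euler's identity the vanishing of all partials already forces F = 0, so the equation of the
hypersurface drops out of the condition. -/
theorem isSmoothForm_iff {F : MvPolynomial ι ℂ} (hF : F.IsHomogeneous 3) :
    IsSmoothForm F ↔ ∀ x, polar F x x = 0 → x = 0 := by
  classical
  constructor
  · intro h x hx
    by_contra hne
    obtain ⟨i, hi⟩ := h x hne (by rw [eval_eq_polar hF, hx]; rfl)
    have := polar_self_single hF x i
    rw [hx] at this
    simp only [LinearMap.zero_apply] at this
    exact hi (by linear_combination -3 * this)
  · intro h x hne _
    by_contra! hall
    refine hne (h x (LinearMap.ext fun w => ?_))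
    rw [polar_self_left hF]
    simp [hall]

theorem polar_add_cube (F : MvPolynomial ι ℂ) (x y : ι → ℂ) :
    polar F (x + y) (x + y) (x + y) = polar F x x x + 3 * polar F x x y + 3 * polar F x y y +
      polar F y y y := by
  simp only [map_add, LinearMap.add_apply]
  rw [polar_swap_left F y x x, polar_swap_right F x y x, polar_swap_left F y x y,
    polar_swap_right F y y x, polar_swap_left F y x y]
  ring

/-- In characteristic zero a symmetric trilinear form is determined by its cubic form; identities
between polars thus reduce to identities between values of cubics. -/
theorem polar_polarization (F : MvPolynomial ι ℂ) (x y z : ι → ℂ) :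
    6 * polar F x y z = polar F (x + y + z) (x + y + z) (x + y + z)
      - polar F (x + y) (x + y) (x + y) - polar F (x + z) (x + z) (x + z)
      - polar F (y + z) (y + z) (y + z) + polar F x x x + polar F y y y + polar F z z z := by
  simp only [polar_add_cube]
  simp only [map_add, LinearMap.add_apply]
  rw [polar_swap_left F y x z]
  ring

/-! ### Restriction of a cubic to subspaces and to lines. -/

omit [Fintype ι] in
theorem eval_pullback (b : κ → ι → ℂ) (F : MvPolynomial ι ℂ) (y : κ → ℂ) :
    eval y (pullback b F) = eval (∑ k, y k • b k) F := by
  rw [pullback]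
  induction F using MvPolynomial.induction_on with
  | C a => simp
  | add p q hp hq => simp only [map_add, hp, hq]
  | mul_X p i hp =>
    rw [map_mul, map_mul, map_mul, hp, aeval_X]
    simp [mul_comm]

omit [Fintype ι] in
theorem isHomogeneous_pullback (b : κ → ι → ℂ) {F : MvPolynomial ι ℂ} {d : ℕ}
    (hF : F.IsHomogeneous d) : (pullback b F).IsHomogeneous d := by
  have := hF.aeval (fun i => ∑ k, C (b k i) * X k : ι → MvPolynomial κ ℂ) (n := 1) fun i =>
    IsHomogeneous.sum _ _ _ fun k _ => by
      simpa using (isHomogeneous_C κ (b k i)).mul (isHomogeneous_X ℂ k)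
  simpa [pullback] using this

theorem polar_pullback (b : κ → ι → ℂ) {F : MvPolynomial ι ℂ} (hF : F.IsHomogeneous 3)
    (x y z : κ → ℂ) :
    polar (pullback b F) x y z =
      polar F (∑ k, x k • b k) (∑ k, y k • b k) (∑ k, z k • b k) := by
  have h := polar_polarization (pullback b F) x y z
  simp only [← eval_eq_polar (isHomogeneous_pullback b hF), eval_pullback, eval_eq_polar hF,
    Pi.add_apply, add_smul, Finset.sum_add_distrib] at h
  rw [← polar_polarization] at h
  exact mul_left_cancel₀ (by norm_num) h

omit [Fintype ι] in
theorem eval_alongLine {F : MvPolynomial ι ℂ} (p w : ι → ℂ) (t : ℂ) :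
    (alongLine F p w).eval t = eval (p + t • w) F := by
  rw [alongLine]
  induction F using MvPolynomial.induction_on with
  | C a => simp
  | add p q hp hq => simp only [map_add, Polynomial.eval_add, hp, hq]
  | mul_X p i hp =>
    rw [map_mul, Polynomial.eval_mul, map_mul, hp, aeval_X]
    simp [mul_comm t]

theorem alongLine_eq {F : MvPolynomial ι ℂ} (hF : F.IsHomogeneous 3) (p w : ι → ℂ) :
    alongLine F p w = Polynomial.C (polar F p p p) +
      Polynomial.C (3 * polar F p p w) * Polynomial.X +
      Polynomial.C (3 * polar F p w w) * Polynomial.X ^ 2 +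
      Polynomial.C (polar F w w w) * Polynomial.X ^ 3 := by
  refine Polynomial.funext fun t => ?_
  rw [eval_alongLine, eval_eq_polar hF, polar_add_cube]
  simp
  ring

/-- At an Eckardt point `p`, the form `polar F p` vanishes on the tangent space. -/
theorem IsEckardtPoint.polar_eq_zero {F : MvPolynomial ι ℂ} (hF : F.IsHomogeneous 3)
    {p : ℙ ℂ (ι → ℂ)} (hp : IsEckardtPoint F p) {v w : ι → ℂ}
    (hv : v ∈ tangentSpace F p.rep) (hw : w ∈ tangentSpace F p.rep) :
    polar F p.rep v w = 0 := by
  -- Multiplicity three kills the t² coefficient 3Φ(p,w,w) of F(p + tw); polarization then treats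
  -- two distinct vectors.
  have key : ∀ w ∈ tangentSpace F p.rep, polar F p.rep w w = 0 := fun w hw => by
    have h := Polynomial.X_pow_dvd_iff.1 (hp.2.2.1 w hw) 2 (by norm_num)
    rw [alongLine_eq hF] at h
    simpa [Polynomial.coeff_X, Polynomial.coeff_C, Polynomial.coeff_C_mul, -map_mul] using h
  have h := key _ (add_mem hv hw)
  simp only [map_add, LinearMap.add_apply, key v hv, key w hw] at h
  rw [polar_swap_right F _ w v] at h
  linear_combination h / 2

/-! ### Integrality over forms without common zeros -/

/-- Nullstellensatz: every variable vanishes on the zero locus of J, so lies in the radical of J,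
and the ideal of variables is finitely generated. -/
theorem exists_idealOfVars_pow_le (J : Ideal (MvPolynomial κ ℂ))
    (hJ : ∀ x : κ → ℂ, (∀ f ∈ J, eval x f = 0) → x = 0) : ∃ N, idealOfVars κ ℂ ^ N ≤ J := by
  refine Ideal.exists_pow_le_of_le_radical_of_fg ?_ (idealOfVars_fg κ ℂ)
  rw [← vanishingIdeal_zeroLocus_eq_radical (K := ℂ) J, Ideal.span_le]
  rintro _ ⟨i, rfl⟩ x hx
  have : x = 0 := hJ x fun f hf => by simpa [coe_aeval_eq_eval] using hx f hf
  simp [this]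

omit [Fintype κ] in
theorem homogeneousComponent_mul_of_isHomogeneous {d e : ℕ} (h g : MvPolynomial κ ℂ)
    (hg : g.IsHomogeneous d) :
    homogeneousComponent (e + d) (h * g) = homogeneousComponent e h * g := by
  conv_lhs => rw [← sum_homogeneousComponent h, Finset.sum_mul, map_sum]
  have hterm : ∀ i, homogeneousComponent (e + d) (homogeneousComponent i h * g) =
      if i = e then homogeneousComponent i h * g else 0 := fun i => by
    rw [homogeneousComponent_of_mem (n := i + d)
      ((homogeneousComponent_isHomogeneous i h).mul hg)]
    simp [eq_comm]
  simp only [hterm, Finset.sum_ite_eq', Finset.mem_range]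
  split_ifs with he
  · rfl
  · rw [homogeneousComponent_eq_zero _ _ (by omega), zero_mul]

/-- Monomials of degree at most N + d generate. A form of larger degree lies in the ideal (gᵢ), and
its coefficients there may be taken homogeneous of degree lower by d, so induction on the degree
applies. -/
theorem finite_adjoin_of_idealOfVars_pow_le {τ : Type*} [Fintype τ] {d N : ℕ} (hd : 0 < d)
    (g : τ → MvPolynomial κ ℂ) (hg : ∀ i, (g i).IsHomogeneous d)
    (hN : idealOfVars κ ℂ ^ N ≤ Ideal.span (Set.range g)) :
    Module.Finite (Algebra.adjoin ℂ (Set.range g)) (MvPolynomial κ ℂ) := by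
  set S := Algebra.adjoin ℂ (Set.range g) with hS
  set M : Submodule S (MvPolynomial κ ℂ) :=
    Submodule.span S ((fun e => monomial e (1 : ℂ)) '' {e : κ →₀ ℕ | e.degree ≤ N + d}) with hM
  have hC : ∀ (c : ℂ) (f), f ∈ M → C c * f ∈ M := fun c f hf =>
    M.smul_mem (algebraMap ℂ S c) hf
  have key : ∀ n, ∀ f : MvPolynomial κ ℂ, f.IsHomogeneous n → f ∈ M := by
    intro n
    induction n using Nat.strong_induction_on with
    | _ n ih =>
      intro f hf
      by_cases hn : n ≤ N + d
      · rw [f.as_sum]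
        refine sum_mem fun e he => ?_
        rw [← mul_one (coeff e f), ← C_mul_monomial]
        refine hC _ _ (Submodule.subset_span ⟨e, ?_, rfl⟩)
        exact ((DFunLike.congr_fun Finsupp.degree_eq_weight_one e).trans
          (hf (mem_support_iff.1 he))).trans_le hn
      · obtain ⟨e, rfl⟩ : ∃ e, n = e + d := ⟨n - d, by omega⟩
        have hfJ : f ∈ Ideal.span (Set.range g) := hN <| by
          rw [mem_pow_idealOfVars_iff]
          intro x hx
          have hxd : x.degree = e + d := (DFunLike.congr_fun Finsupp.degree_eq_weight_one x).trans
            (hf (mem_support_iff.1 hx))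
          omega
        obtain ⟨c, rfl⟩ := Ideal.mem_span_range_iff_exists_fun.1 hfJ
        have h1 := homogeneousComponent_of_mem (m := e + d) hf
        rw [if_pos rfl, map_sum] at h1
        rw [← h1]
        refine sum_mem fun i _ => ?_
        rw [homogeneousComponent_mul_of_isHomogeneous _ _ (hg i), mul_comm]
        exact M.smul_mem (⟨g i, Algebra.subset_adjoin ⟨i, rfl⟩⟩ : S)
          (ih e (by omega) _ (homogeneousComponent_isHomogeneous _ _))
  refine ⟨Submodule.fg_def.2 ⟨_, (Finsupp.finite_of_degree_le (N + d)).image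
    (fun e => monomial e (1 : ℂ)), ?_⟩⟩
  refine eq_top_iff.2 fun f _ => ?_
  rw [← sum_homogeneousComponent f]
  exact sum_mem fun i _ => key i _ (homogeneousComponent_isHomogeneous _ _)

/-! ### Derivations and integral elements -/

/-- Differentiating a relation q(x) = 0 in K with coefficients killed by D gives q′(x)·Dx = 0, and
in characteristic zero q′(x) ≠ 0 when q has minimal degree. -/
theorem derivation_eq_zero_of_isIntegral {R K : Type*} [CommRing R] [IsDomain R] [Algebra ℂ R] [Field K]
    [Algebra R K] [Algebra ℂ K] [IsScalarTower ℂ R K] (D : Derivation ℂ R K)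
    (hker : ∀ a, algebraMap R K a = 0 → D a = 0) (S : Subalgebra ℂ R) (hS : ∀ s ∈ S, D s = 0)
    {x : R} (hx : IsIntegral S x) : D x = 0 := by
  classical
  have hD : ∀ q : Polynomial S, D (Polynomial.aeval x q) =
      algebraMap R K (Polynomial.aeval x q.derivative) * D x := fun q => by
    induction q using Polynomial.induction_on' with
    | add p q hp hq => simp [hp, hq, add_mul]
    | monomial n a =>
      have ha : D (algebraMap S R a) = 0 := hS _ a.2
      rw [Polynomial.aeval_monomial, D.leibniz, ha, smul_zero, add_zero, D.leibniz_pow,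
        Polynomial.derivative_monomial, Polynomial.aeval_monomial]
      rw [nsmul_eq_mul]
      simp only [Algebra.smul_def, map_mul, map_pow, map_natCast]
      ring
  -- The map from S to K need not be injective, so the leading coefficient is required to be nonzero
  -- in K and not merely in S.
  let P : ℕ → Prop := fun n => ∃ q : Polynomial S, q.natDegree = n ∧
    algebraMap R K (algebraMap S R q.leadingCoeff) ≠ 0 ∧
    algebraMap R K (Polynomial.aeval x q) = 0
  have hP : ∃ n, P n := by
    obtain ⟨q, hq, hq0⟩ := hx
    refine ⟨_, q, rfl, by simp [hq.leadingCoeff], ?_⟩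
    rw [Polynomial.aeval_def, hq0, map_zero]
  obtain ⟨q, hqn, hlc, hq0⟩ := Nat.find_spec hP
  have hpos : q.natDegree ≠ 0 := fun h0 => by
    rw [Polynomial.eq_C_of_natDegree_eq_zero h0, Polynomial.aeval_C] at hq0
    rw [Polynomial.leadingCoeff, h0] at hlc
    exact hlc hq0
  have : CharZero K := charZero_of_injective_algebraMap (algebraMap ℂ K).injective
  have : CharZero S := charZero_of_injective_algebraMap (algebraMap ℂ S).injective
  have h := hD q
  rw [hker _ hq0] at h
  refine (mul_eq_zero.1 h.symm).resolve_left fun h0 => ?_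
  refine Nat.find_min hP (m := q.derivative.natDegree) ?_ ⟨_, rfl, ?_, h0⟩
  · rw [← hqn, Polynomial.natDegree_derivative]
    omega
  · rw [Polynomial.leadingCoeff_derivative, map_mul, map_mul, map_natCast, map_natCast]
    exact mul_ne_zero hlc (Nat.cast_ne_zero.2 hpos)

/-! ### The Hessian does not vanish on components of a smooth cubic -/

theorem mkDerivation_apply {K : Type*} [Field K] [Algebra (MvPolynomial κ ℂ) K] [Algebra ℂ K]
    [IsScalarTower ℂ (MvPolynomial κ ℂ) K] (r : κ → K) (f : MvPolynomial κ ℂ) :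
    mkDerivation ℂ r f = ∑ i, algebraMap _ K (pderiv i f) * r i := by
  classical
  induction f using MvPolynomial.induction_on with
  | C a => simp
  | add p q hp hq => simp [hp, hq, add_mul, Finset.sum_add_distrib]
  | mul_X p i hp =>
    rw [Derivation.leibniz, hp, mkDerivation_X]
    simp only [Derivation.leibniz, pderiv_X, smul_eq_mul, map_add, map_mul, add_mul,
      Finset.sum_add_distrib, Algebra.smul_def, Finset.mul_sum]
    congr 1
    · simp [Pi.single_apply]
    · exact Finset.sum_congr rfl fun j _ => by ring

theorem pderiv_smooth_zero {G : MvPolynomial κ ℂ} {d : ℕ} (hd : d ≠ 0) (hG : G.IsHomogeneous d)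
    (hs : IsSmoothForm G) (x : κ → ℂ) (hx : ∀ i, eval x (pderiv i G) = 0) : x = 0 := by
  by_contra hne
  have h := eval_euler hG x
  simp only [hx, mul_zero, Finset.sum_const_zero] at h
  obtain ⟨i, hi⟩ := hs x hne ((mul_eq_zero.1 h.symm).resolve_left (Nat.cast_ne_zero.2 hd))
  exact hi (hx i)

/-- If g divided the Hessian determinant, the Hessian matrix would be singular over the fraction
field K of the ring modulo g. A kernel vector r defines a nonzero derivation D = ∑ rᵢ∂ᵢ into K that
kills every ∂ⱼG. It also kills g, and then finiteness over the algebra generated by the ∂ⱼG forces D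
= 0. -/
theorem hessianDet_notMem_span_of_prime_dvd [DecidableEq κ] [Nontrivial κ]
    {G g : MvPolynomial κ ℂ} (hG : G.IsHomogeneous 3) (hs : IsSmoothForm G) (hg : Prime g)
    (hgG : g ∣ G) : ¬ g ∣ hessianDet G := by
  intro hH
  obtain ⟨N, hN⟩ := exists_idealOfVars_pow_le (Ideal.span (Set.range fun i => pderiv i G))
    fun x hx => pderiv_smooth_zero three_ne_zero hG hs x
      fun i => hx _ (Ideal.subset_span ⟨i, rfl⟩)
  have hfin := finite_adjoin_of_idealOfVars_pow_le two_pos (fun i => pderiv i G)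
    (fun i => hG.pderiv) hN
  set S := Algebra.adjoin ℂ (Set.range fun i => pderiv i G) with hSdef
  have : (Ideal.span {g}).IsPrime := (Ideal.span_singleton_prime hg.ne_zero).2 hg
  let K := FractionRing (MvPolynomial κ ℂ ⧸ Ideal.span {g})
  have hker : ∀ a : MvPolynomial κ ℂ, algebraMap _ K a = 0 ↔ g ∣ a := fun a => by
    rw [IsScalarTower.algebraMap_apply _ (MvPolynomial κ ℂ ⧸ Ideal.span {g}) K,
      FaithfulSMul.algebraMap_eq_zero_iff, Ideal.Quotient.algebraMap_eq,
      Ideal.Quotient.eq_zero_iff_mem, Ideal.mem_span_singleton]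
  obtain ⟨r, hr0, hr⟩ := Matrix.exists_mulVec_eq_zero_iff.2
    (show ((Matrix.of fun i j => pderiv i (pderiv j G)).map (algebraMap _ K)).det = 0 by
      rw [← RingHom.mapMatrix_apply, ← RingHom.map_det]
      exact (hker _).2 hH)
  let D := mkDerivation ℂ r
  have hDg : ∀ j, D (pderiv j G) = 0 := fun j => by
    have h := congrFun hr j
    simp only [Matrix.mulVec, dotProduct, Matrix.map_apply, Matrix.of_apply, Pi.zero_apply] at h
    rw [mkDerivation_apply, ← h]
    exact Finset.sum_congr rfl fun i _ => by rw [pderiv_comm]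
  -- Applying D to Euler's identity 3G = ∑ xᵢ∂ᵢG gives 3·DG = DG.
  have hDG : D G = 0 := by
    have h := congrArg D hG.sum_X_mul_pderiv
    simp only [map_sum, Derivation.leibniz, hDg, smul_zero, zero_add, map_nsmul] at h
    have h2 : D G = ∑ i, pderiv i G • D (X i) := by
      simp only [D, mkDerivation_apply r G, mkDerivation_X, Algebra.smul_def]
    rw [← h2] at h
    have : CharZero K := charZero_of_injective_algebraMap (algebraMap ℂ K).injective
    have h3 : (2 : K) * D G = 0 := by
      have h4 : (3 : ℕ) • D G = 3 * D G := by simp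
      rw [h4] at h
      linear_combination -h
    exact (mul_eq_zero.1 h3).resolve_left two_ne_zero
  obtain ⟨c, hc⟩ := hgG
  -- If g² divided G, then g would divide all partials, hence a power of every variable; with two
  -- distinct variables this is impossible.
  have hcg : ¬ g ∣ c := by
    rintro ⟨c', rfl⟩
    have hle : Ideal.span (Set.range fun i => pderiv i G) ≤ Ideal.span {g} := by
      rw [Ideal.span_le]
      rintro _ ⟨i, rfl⟩
      rw [SetLike.mem_coe, Ideal.mem_span_singleton]
      change g ∣ pderiv i G
      rw [hc, pderiv_mul, pderiv_mul]
      exact Dvd.intro (pderiv i g * c' + (pderiv i g * c' + g * pderiv i c')) (by ring)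
    have hX : ∀ k : κ, g ∣ X k := fun k => by
      refine hg.dvd_of_dvd_pow (n := N) (Ideal.mem_span_singleton.1 (hle (hN ?_)))
      exact Ideal.pow_mem_pow (Ideal.subset_span (Set.mem_range_self k)) N
    obtain ⟨i, j, hij⟩ := exists_pair_ne κ
    have hass := (X_prime (R := ℂ) (i := i)).irreducible.dvd_iff.1 (hX i)
    have := (hass.resolve_left hg.not_isUnit).dvd.trans (hX j)
    exact hij (X_dvd_X.1 this)
  have hDg0 : D g = 0 := by
    rw [hc, Derivation.leibniz, Algebra.smul_def, Algebra.smul_def, (hker g).2 dvd_rfl, zero_mul,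
      zero_add] at hDG
    exact (mul_eq_zero.1 hDG).resolve_left fun h => hcg ((hker c).1 h)
  refine hr0 (funext fun k => ?_)
  have hint : IsIntegral S (X k : MvPolynomial κ ℂ) := Algebra.IsIntegral.isIntegral _
  have hDX : D (X k) = 0 := by
    refine derivation_eq_zero_of_isIntegral D (fun a ha => ?_) S (fun s hs => ?_) hint
    · obtain ⟨b, rfl⟩ := (hker a).1 ha
      rw [Derivation.leibniz, hDg0, smul_zero, add_zero, Algebra.smul_def, (hker g).2 dvd_rfl,
        zero_mul]
    · induction hs using Algebra.adjoin_induction with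
      | mem x hx =>
        obtain ⟨i, rfl⟩ := hx
        exact hDg i
      | algebraMap c => exact D.map_algebraMap c
      | add x y _ _ hx hy => rw [map_add, hx, hy, add_zero]
      | mul x y _ _ hx hy => rw [Derivation.leibniz, hx, hy, smul_zero, smul_zero, add_zero]
  simpa [D, mkDerivation_X] using hDX

/-! ### Dimension of the intersection with the Hessian -/

theorem ringKrullDim_mvPolynomial : ringKrullDim (MvPolynomial κ ℂ) = Fintype.card κ := by
  rw [MvPolynomial.ringKrullDim_of_isNoetherianRing, ringKrullDim_eq_zero_of_field, zero_add,
    Nat.card_eq_fintype_card]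

omit [Fintype κ] in
theorem mem_vanishingIdeal {V : Set (κ → ℂ)} {p : MvPolynomial κ ℂ} :
    p ∈ MvPolynomial.vanishingIdeal ℂ V ↔ ∀ x ∈ V, eval x p = 0 := by
  simp only [mem_vanishingIdeal_iff, ← coe_aeval_eq_eval, RingHom.coe_coe]

omit [Fintype κ] in
-- A translation is an automorphism of the polynomial ring exchanging the two points.
theorem height_vanishingIdeal_singleton_eq (x y : κ → ℂ) :
    (MvPolynomial.vanishingIdeal ℂ {x} : Ideal (MvPolynomial κ ℂ)).height =
      (MvPolynomial.vanishingIdeal ℂ {y} : Ideal (MvPolynomial κ ℂ)).height := by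
  let f : (κ → ℂ) → MvPolynomial κ ℂ →ₐ[ℂ] MvPolynomial κ ℂ := fun a => aeval fun i => X i + C (a i)
  have hf : ∀ a, (f a).comp (f (-a)) = AlgHom.id ℂ _ := fun a => by
    ext i
    simp [f]
  let e : MvPolynomial κ ℂ ≃ₐ[ℂ] MvPolynomial κ ℂ := AlgEquiv.ofAlgHom (f (y - x)) (f (-(y - x)))
    (hf _) (by simpa using hf (-(y - x)))
  have he : ∀ p : MvPolynomial κ ℂ, aeval x (e p) = aeval y p := fun p => by
    change aeval x (aeval (fun i => X i + C ((y - x) i)) p) = aeval y p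
    induction p using MvPolynomial.induction_on with
    | C a => simp
    | add p q hp hq => rw [map_add, map_add, map_add, hp, hq]
    | mul_X p i hp => rw [map_mul, map_mul, map_mul, hp, aeval_X]; simp
  rw [← RingEquiv.height_comap e.toRingEquiv]
  congr 1
  ext p
  rw [Ideal.mem_comap, mem_vanishingIdeal_singleton_iff, mem_vanishingIdeal_singleton_iff, ← he]
  rfl

theorem card_le_height_vanishingIdeal_singleton (x : κ → ℂ) :
    (Fintype.card κ : ℕ∞) ≤
      (MvPolynomial.vanishingIdeal ℂ {x} : Ideal (MvPolynomial κ ℂ)).height := by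
  have h : ringKrullDim (MvPolynomial κ ℂ) ≤
      ((MvPolynomial.vanishingIdeal ℂ {x} : Ideal (MvPolynomial κ ℂ)).height : WithBot ℕ∞) := by
    rw [ringKrullDim_le_iff_isMaximal_height_le]
    intro M hM
    obtain ⟨y, rfl⟩ := isMaximal_iff_eq_vanishingIdeal_singleton.1 hM
    rw [height_vanishingIdeal_singleton_eq y x]
  rw [ringKrullDim_mvPolynomial] at h
  exact_mod_cast h

/-- The ideal of the origin has height equal to the number of variables, and passing to the quotient
by two of its elements lowers the dimension by at most two. -/
theorem card_le_ringKrullDim_quotient_pair {g h : MvPolynomial κ ℂ} (hg : eval 0 g = 0)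
    (hh : eval 0 h = 0) :
    (Fintype.card κ : WithBot ℕ∞) ≤
      ringKrullDim (MvPolynomial κ ℂ ⧸ Ideal.span {g, h}) + 2 := by
  have hle : Ideal.span {g, h} ≤ (MvPolynomial.vanishingIdeal ℂ {(0 : κ → ℂ)} : Ideal _) := by
    rw [Ideal.span_le]
    rintro f (rfl | rfl)
    · exact mem_vanishingIdeal.2 fun x hx => by rw [Set.mem_singleton_iff.1 hx, hg]
    · exact mem_vanishingIdeal.2 fun x hx => by rw [Set.mem_singleton_iff.1 hx, hh]
  have h1 := height_le_ringKrullDim_quotient_add_spanFinrank hle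
  have h2 : (Ideal.span {g, h}).spanFinrank ≤ 2 :=
    (Submodule.spanFinrank_span_le_ncard_of_finite (Set.toFinite _)).trans
      (Set.ncard_insert_le g {h} |>.trans (by simp))
  have h0 : ((Fintype.card κ : ℕ∞) : WithBot ℕ∞) ≤ _ :=
    WithBot.coe_le_coe.2 (card_le_height_vanishingIdeal_singleton (0 : κ → ℂ))
  refine (h0.trans h1).trans ?_
  gcongr
  exact_mod_cast h2

theorem exists_prime_dvd_mem_of_mem {R : Type*} [CommRing R] [IsDomain R]
    [UniqueFactorizationMonoid R] {P : Ideal R} (hP : P.IsPrime) {g : R} (hg : g ≠ 0)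
    (hgP : g ∈ P) : ∃ f, f ∣ g ∧ Prime f ∧ f ∈ P := by
  obtain ⟨u, hu⟩ := UniqueFactorizationMonoid.factors_prod hg
  rw [← hu, Ideal.mul_unit_mem_iff_mem _ u.isUnit] at hgP
  obtain ⟨f, hf, hfP⟩ := (hP.multiset_prod_mem_iff_exists_mem _).1 hgP
  exact ⟨f, UniqueFactorizationMonoid.dvd_of_mem_factors hf,
    UniqueFactorizationMonoid.prime_of_factor f hf, hfP⟩

/-- A chain of primes containing g and h extends downwards by two steps, 0 ⊂ (f) ⊂ …, with f a prime
factor of g lying in the smallest prime of the chain; the second inclusion is strict because f does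
not divide h. -/
theorem ringKrullDim_quotient_pair_add_two_le {g h : MvPolynomial κ ℂ} (hg : g ≠ 0)
    (hgh : ∀ f, Prime f → f ∣ g → ¬ f ∣ h) :
    ringKrullDim (MvPolynomial κ ℂ ⧸ Ideal.span {g, h}) + 2 ≤ Fintype.card κ := by
  rw [← ringKrullDim_mvPolynomial]
  by_cases htop : Ideal.span {g, h} = ⊤
  · have : Subsingleton (MvPolynomial κ ℂ ⧸ Ideal.span {g, h}) :=
      Ideal.Quotient.subsingleton_iff.2 htop
    rw [ringKrullDim_eq_bot_of_subsingleton]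
    simp
  have : Nonempty (PrimeSpectrum.zeroLocus (R := MvPolynomial κ ℂ) (Ideal.span {g, h})) := by
    rwa [Set.nonempty_coe_sort, Set.nonempty_iff_ne_empty, ne_eq,
      PrimeSpectrum.zeroLocus_empty_iff_eq_top]
  rw [ringKrullDim_quotient, Order.krullDim_eq_iSup_length, ringKrullDim,
    Order.krullDim_eq_iSup_length, show (2 : WithBot ℕ∞) = ((2 : ℕ∞) : WithBot ℕ∞) from rfl,
    ← WithBot.coe_add, ENat.iSup_add, WithBot.coe_le_coe, iSup_le_iff]
  intro l
  have hmem : ∀ f ∈ ({g, h} : Set (MvPolynomial κ ℂ)), f ∈ l.head.1.asIdeal :=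
    fun f hf => l.head.2 (Ideal.subset_span hf)
  obtain ⟨f, hfg, hfp, hf⟩ :=
    exists_prime_dvd_mem_of_mem l.head.1.isPrime hg (hmem g (by simp))
  have hfP : (Ideal.span {f}).IsPrime := (Ideal.span_singleton_prime hfp.ne_zero).2 hfp
  let p₀ : PrimeSpectrum (MvPolynomial κ ℂ) := ⟨⊥, Ideal.isPrime_bot⟩
  let p₁ : PrimeSpectrum (MvPolynomial κ ℂ) := ⟨Ideal.span {f}, hfP⟩
  have h01 : p₀ < p₁ := by
    refine lt_of_le_of_ne (show (⊥ : Ideal _) ≤ _ from bot_le) fun he => hfp.ne_zero ?_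
    have : (⊥ : Ideal (MvPolynomial κ ℂ)) = Ideal.span {f} := congrArg (·.asIdeal) he
    exact Ideal.span_singleton_eq_bot.1 this.symm
  have h12 : p₁ < l.head.1 := by
    refine lt_of_le_of_ne (show Ideal.span {f} ≤ l.head.1.asIdeal from
      (Ideal.span_singleton_le_iff_mem _).2 hf) fun he => hgh f hfp hfg ?_
    have : Ideal.span {f} = l.head.1.asIdeal := congrArg (·.asIdeal) he
    rw [← Ideal.mem_span_singleton, this]
    exact hmem h (by simp)
  let l' : LTSeries (PrimeSpectrum (MvPolynomial κ ℂ)) :=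
    ((l.map Subtype.val (Subtype.strictMono_coe _)).cons p₁ h12).cons p₀ h01
  have hl' : l'.length = l.length + 2 := by
    change 0 + (0 + l.length + 1) + 1 = l.length + 2
    omega
  refine le_trans ?_ (le_iSup _ l')
  rw [hl', Nat.cast_add, Nat.cast_two]

/-! ### Projective algebraic sets and linear embeddings -/

theorem eval_smul_of_isHomogeneous {f : MvPolynomial ι ℂ} {d : ℕ} (hf : f.IsHomogeneous d)
    (a : ℂ) (v : ι → ℂ) : eval (a • v) f = a ^ d * eval v f := by
  rw [eval_eq', eval_eq', Finset.mul_sum]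
  refine Finset.sum_congr rfl fun e he => ?_
  have hed : ∑ i, e i = d := by
    rw [← hf (mem_support_iff.1 he), ← Finsupp.degree_eq_sum]
    exact DFunLike.congr_fun Finsupp.degree_eq_weight_one e
  simp only [Pi.smul_apply, smul_eq_mul, mul_pow, Finset.prod_mul_distrib,
    Finset.prod_pow_eq_pow_sum, hed]
  ring

theorem eval_rep_mk_eq_zero_iff {f : MvPolynomial ι ℂ} {d : ℕ} (hf : f.IsHomogeneous d)
    {v : ι → ℂ} (hv : v ≠ 0) : eval (Projectivization.mk ℂ v hv).rep f = 0 ↔ eval v f = 0 := by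
  obtain ⟨a, ha⟩ := Projectivization.exists_smul_eq_mk_rep ℂ v hv
  rw [← ha, Units.smul_def, eval_smul_of_isHomogeneous hf]
  simp

/-- The substitution of a linear map into a polynomial. -/
def linSubst (A : (κ → ℂ) →ₗ[ℂ] ι → ℂ) : MvPolynomial ι ℂ →ₐ[ℂ] MvPolynomial κ ℂ := by
  classical
  exact aeval fun i => ∑ k, C (A (Pi.single k 1) i) * X k

omit [Fintype ι] in
theorem eval_linSubst (A : (κ → ℂ) →ₗ[ℂ] ι → ℂ) (f : MvPolynomial ι ℂ) (y : κ → ℂ) :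
    eval y (linSubst A f) = eval (A y) f := by
  classical
  have h := eval_pullback (fun k => A (Pi.single k 1)) f y
  have hy : ∑ k, y k • A (Pi.single k 1) = A y := by
    conv_rhs => rw [← Finset.univ_sum_single y, map_sum]
    refine Finset.sum_congr rfl fun k _ => ?_
    rw [← map_smul, ← Pi.single_smul, smul_eq_mul, mul_one]
  rw [hy] at h
  exact h

omit [Fintype ι] in
theorem isHomogeneous_linSubst (A : (κ → ℂ) →ₗ[ℂ] ι → ℂ) {f : MvPolynomial ι ℂ} {d : ℕ}
    (hf : f.IsHomogeneous d) : (linSubst A f).IsHomogeneous d := by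
  classical
  exact isHomogeneous_pullback (fun k => A (Pi.single k 1)) hf

omit [Fintype ι] [Fintype κ] in
theorem affineCone_map (A : (κ → ℂ) →ₗ[ℂ] ι → ℂ) (hA : Function.Injective A)
    (Z : Set (ℙ ℂ (κ → ℂ))) :
    affineCone (Projectivization.map A hA '' Z) = A '' affineCone Z := by
  have h : ∀ x : ℙ ℂ (κ → ℂ), (Projectivization.map A hA x).submodule = x.submodule.map A := by
    intro x
    induction x using Projectivization.ind with
    | h v hv =>
      rw [Projectivization.map_mk, Projectivization.submodule_mk, Projectivization.submodule_mk,
        Submodule.map_span, Set.image_singleton]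
  ext v
  constructor
  · rintro ⟨_, ⟨x, hx, rfl⟩, hv⟩
    rw [h] at hv
    obtain ⟨w, hw, rfl⟩ := hv
    exact ⟨w, ⟨x, hx, hw⟩, rfl⟩
  · rintro ⟨w, ⟨x, hx, hw⟩, rfl⟩
    exact ⟨_, ⟨x, hx, rfl⟩, by rw [h]; exact ⟨w, hw, rfl⟩⟩

/-- Restriction along A is a surjection of polynomial rings, split by a left inverse of A, and
identifies the two coordinate rings. -/
theorem ringKrullDim_coordRing_map (A : (κ → ℂ) →ₗ[ℂ] ι → ℂ) (hA : Function.Injective A)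
    (Z : Set (ℙ ℂ (κ → ℂ))) :
    ringKrullDim (CoordRing (Projectivization.map A hA '' Z)) = ringKrullDim (CoordRing Z) := by
  obtain ⟨B, hB⟩ := A.exists_leftInverse_of_injective (LinearMap.ker_eq_bot.2 hA)
  have hBA : ∀ f, linSubst A (linSubst B f) = f := fun f => by
    refine MvPolynomial.funext fun y => ?_
    rw [eval_linSubst, eval_linSubst, ← LinearMap.comp_apply, hB, LinearMap.id_apply]
  let ψ : MvPolynomial ι ℂ →+* CoordRing Z :=
    (Ideal.Quotient.mk _).comp (linSubst A : MvPolynomial ι ℂ →+* MvPolynomial κ ℂ)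
  have hψ : Function.Surjective ψ := Ideal.Quotient.mk_surjective.comp fun f => ⟨_, hBA f⟩
  have hker : MvPolynomial.vanishingIdeal ℂ (affineCone (Projectivization.map A hA '' Z)) =
      RingHom.ker ψ := by
    ext f
    rw [RingHom.mem_ker, RingHom.comp_apply, Ideal.Quotient.eq_zero_iff_mem, mem_vanishingIdeal,
      mem_vanishingIdeal, affineCone_map, Set.forall_mem_image]
    simp only [RingHom.coe_coe, eval_linSubst]
  exact ringKrullDim_eq_of_ringEquiv
    ((Ideal.quotEquivOfEq hker).trans (RingHom.quotientKerEquivOfSurjective hψ))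

omit [Fintype ι] [Fintype κ] in
theorem mem_image_map_iff {A : (κ → ℂ) →ₗ[ℂ] ι → ℂ} (hA : Function.Injective A)
    {B : (ι → ℂ) →ₗ[ℂ] κ → ℂ} (hB : ∀ y, B (A y) = y) {Z : Set (ℙ ℂ (κ → ℂ))}
    {z : ℙ ℂ (ι → ℂ)} : z ∈ Projectivization.map A hA '' Z ↔
      ∃ h : B z.rep ≠ 0, A (B z.rep) = z.rep ∧ Projectivization.mk ℂ (B z.rep) h ∈ Z := by
  constructor
  · rintro ⟨x, hx, rfl⟩
    induction x using Projectivization.ind with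
    | h v hv =>
      obtain ⟨a, ha⟩ := Projectivization.exists_smul_eq_mk_rep ℂ (A v)
        (map_zero A ▸ hA.ne hv)
      have hBr : B (Projectivization.map A hA (Projectivization.mk ℂ v hv)).rep = a • v := by
        rw [Projectivization.map_mk, ← ha, Units.smul_def, map_smul, hB]
        rfl
      rw [hBr]
      refine ⟨(smul_ne_zero_iff_ne a).2 hv, ?_, ?_⟩
      · rw [Projectivization.map_mk, ← ha, Units.smul_def, map_smul]
        rfl
      rwa [(Projectivization.mk_eq_mk_iff ℂ _ _ _ hv).2 ⟨a, rfl⟩]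
  · rintro ⟨h, hAB, hZ⟩
    refine ⟨_, hZ, ?_⟩
    rw [Projectivization.map_mk]
    conv_rhs => rw [← z.mk_rep]
    congr 1

theorem IsZariskiClosed.map {Z : Set (ℙ ℂ (κ → ℂ))} (hZ : IsZariskiClosed Z)
    (A : (κ → ℂ) →ₗ[ℂ] ι → ℂ) (hA : Function.Injective A) :
    IsZariskiClosed (Projectivization.map A hA '' Z) := by
  obtain ⟨S, hS, rfl⟩ := hZ
  obtain ⟨B, hB⟩ := A.exists_leftInverse_of_injective (LinearMap.ker_eq_bot.2 hA)
  -- The image is cut out by the equations of Z pulled back along the left inverse B, together with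
  -- the linear equations ABz = z of the range of A.
  refine ⟨linSubst B '' S ∪
    Set.range fun i => linSubst (A ∘ₗ B - LinearMap.id) (X i : MvPolynomial ι ℂ), ?_, ?_⟩
  · rintro _ (⟨f, hf, rfl⟩ | ⟨i, rfl⟩)
    · obtain ⟨d, hd⟩ := hS f hf
      exact ⟨d, isHomogeneous_linSubst B hd⟩
    · exact ⟨1, isHomogeneous_linSubst _ (isHomogeneous_X ℂ i)⟩
  ext z
  rw [mem_image_map_iff hA (LinearMap.congr_fun hB)]
  simp only [Set.mem_ofPred_eq, Set.mem_union, or_imp, forall_and, Set.forall_mem_image,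
    Set.forall_mem_range, eval_linSubst, eval_X, LinearMap.sub_apply, LinearMap.comp_apply,
    LinearMap.id_apply, Pi.sub_apply, sub_eq_zero]
  constructor
  · rintro ⟨h, hAB, hZ⟩
    refine ⟨fun f hf => ?_, fun i => congrFun hAB i⟩
    obtain ⟨d, hd⟩ := hS f hf
    exact (eval_rep_mk_eq_zero_iff hd h).1 (hZ f hf)
  · rintro ⟨hZ, hAB⟩
    have hne : B z.rep ≠ 0 := fun h => z.rep_nonzero (by rw [← funext hAB, h, map_zero])
    refine ⟨hne, funext hAB, fun f hf => ?_⟩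
    obtain ⟨d, hd⟩ := hS f hf
    exact (eval_rep_mk_eq_zero_iff hd hne).2 (hZ hf)

theorem HasProjDim.map {Z : Set (ℙ ℂ (κ → ℂ))} {d : ℕ} (hZ : HasProjDim Z d)
    (A : (κ → ℂ) →ₗ[ℂ] ι → ℂ) (hA : Function.Injective A) :
    HasProjDim (Projectivization.map A hA '' Z) d :=
  ⟨hZ.1.map A hA, by rw [ringKrullDim_coordRing_map, hZ.2]⟩

omit [Fintype ι] [Fintype κ] in
theorem submodule_map (A : (κ → ℂ) →ₗ[ℂ] ι → ℂ) (hA : Function.Injective A) (x : ℙ ℂ (κ → ℂ)) :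
    (Projectivization.map A hA x).submodule = x.submodule.map A := by
  induction x using Projectivization.ind with
  | h v hv =>
    rw [Projectivization.map_mk, Projectivization.submodule_mk, Projectivization.submodule_mk,
      Submodule.map_span, Set.image_singleton]

theorem isRegularMap_of_linear {Z : Set (ℙ ℂ (κ → ℂ))} {W : Set (ℙ ℂ (ι → ℂ))} (φ : Z → W)
    (A : (κ → ℂ) →ₗ[ℂ] ι → ℂ) (hφ : ∀ x, (φ x).1.submodule = x.1.submodule.map A) :
    IsRegularMap φ := by
  have hspan : ∀ x, (φ x).1.submodule =
      Submodule.span ℂ {fun k => eval x.1.rep (linSubst A (X k : MvPolynomial ι ℂ))} := fun x => by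
    simp only [eval_linSubst, eval_X]
    rw [hφ, Projectivization.submodule_eq, Submodule.map_span, Set.image_singleton]
  refine fun x => ⟨1, fun k => linSubst A (X k),
    fun k => isHomogeneous_linSubst A (isHomogeneous_X ℂ k), ?_, fun y _ => hspan y⟩
  by_contra! h
  have hx := hspan x
  rw [funext h, show (fun _ : ι => (0 : ℂ)) = 0 from rfl, Submodule.span_zero_singleton] at hx
  have := (φ x).1.finrank_submodule
  rw [hx, finrank_bot] at this
  exact zero_ne_one this

theorem exists_equiv_isRegularMap (A : (κ → ℂ) →ₗ[ℂ] ι → ℂ) (hA : Function.Injective A)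
    (Z : Set (ℙ ℂ (κ → ℂ))) : ∃ φ : Z ≃ ↥(Projectivization.map A hA '' Z),
      (∀ q, (φ q).1 = Projectivization.map A hA q.1) ∧ IsRegularMap φ ∧ IsRegularMap φ.symm := by
  obtain ⟨B, hB⟩ := A.exists_leftInverse_of_injective (LinearMap.ker_eq_bot.2 hA)
  have hφ : ∀ q, (Equiv.Set.image _ Z (Projectivization.map_injective A hA) q).1 =
    Projectivization.map A hA q.1 := fun q => rfl
  refine ⟨Equiv.Set.image _ Z (Projectivization.map_injective A hA), hφ,
    isRegularMap_of_linear _ A fun x => by rw [hφ, submodule_map],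
    isRegularMap_of_linear _ B fun x => ?_⟩
  obtain ⟨q, rfl⟩ := (Equiv.Set.image _ Z (Projectivization.map_injective A hA)).surjective x
  rw [Equiv.symm_apply_apply, hφ, submodule_map, ← Submodule.map_comp, hB, Submodule.map_id]

/-! ### The intersection of a cubic with its Hessian -/

theorem isHomogeneous_hessianDet [DecidableEq κ] {G : MvPolynomial κ ℂ} (hG : G.IsHomogeneous 3) :
    (hessianDet G).IsHomogeneous (Fintype.card κ) := by
  rw [hessianDet, Matrix.det_apply']
  refine IsHomogeneous.sum _ _ _ fun σ _ => ?_
  rw [← zero_add (Fintype.card κ)]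
  refine IsHomogeneous.mul ?_ ?_
  · rw [← map_intCast (C : ℂ →+* MvPolynomial κ ℂ)]
    exact isHomogeneous_C _ _
  · have h := IsHomogeneous.prod Finset.univ
      (fun i => pderiv (σ i) (pderiv i G)) (fun _ => 1) fun i _ => hG.pderiv.pderiv
    simpa using h

/-- Otherwise the ideal of the origin would be minimal over (g, h), so of height at most two by
Krull, although its height is the number of variables. -/
theorem exists_common_zero {g h : MvPolynomial κ ℂ} (hg : eval 0 g = 0) (hh : eval 0 h = 0)
    (hκ : 2 < Fintype.card κ) : ∃ x ≠ 0, eval x g = 0 ∧ eval x h = 0 := by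
  by_contra! H
  have hmin : (MvPolynomial.vanishingIdeal ℂ {(0 : κ → ℂ)} : Ideal (MvPolynomial κ ℂ)) ∈
      (Ideal.span {g, h}).minimalPrimes := by
    refine ⟨⟨inferInstance, ?_⟩, ?_⟩
    · rw [Ideal.span_le]
      rintro f (rfl | rfl)
      · exact mem_vanishingIdeal.2 fun x hx => by rw [Set.mem_singleton_iff.1 hx, hg]
      · exact mem_vanishingIdeal.2 fun x hx => by rw [Set.mem_singleton_iff.1 hx, hh]
    · rintro P ⟨hP, hle⟩ -
      rw [← hP.radical, ← vanishingIdeal_zeroLocus_eq_radical (K := ℂ) P]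
      refine vanishingIdeal_anti_mono fun x hx => ?_
      have hx' : ∀ f ∈ ({g, h} : Set (MvPolynomial κ ℂ)), eval x f = 0 := fun f hf => by
        rw [← coe_aeval_eq_eval]
        exact hx f (hle (Ideal.subset_span hf))
      by_contra hne
      exact H x hne (hx' g (by simp)) (hx' h (by simp))
  have h1 := Ideal.height_le_card_of_mem_minimalPrimes_span (Set.toFinite _) hmin
  have h2 := card_le_height_vanishingIdeal_singleton (0 : κ → ℂ)
  have h3 : ({g, h} : Set (MvPolynomial κ ℂ)).ncard ≤ 2 :=
    (Set.ncard_insert_le g {h}).trans (by simp)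
  have h4 : (Fintype.card κ : ℕ∞) ≤ (2 : ℕ) := h2.trans (h1.trans (Nat.cast_le.2 h3))
  exact absurd (Nat.cast_le.1 h4) (by omega)

theorem hasProjDim_inter_hessianDet [DecidableEq κ] {G : MvPolynomial κ ℂ}
    (hG : G.IsHomogeneous 3) (hs : IsSmoothForm G) {d : ℕ} (hd : Fintype.card κ = d + 3) :
    HasProjDim (hypersurface G ∩ hypersurface (hessianDet G)) d := by
  have hG0 : eval 0 G = 0 := by simpa using eval_smul_of_isHomogeneous hG 0 0
  have hH := isHomogeneous_hessianDet hG
  have hH0 : eval 0 (hessianDet G) = 0 := by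
    simpa [hd] using eval_smul_of_isHomogeneous hH 0 0
  have : Nontrivial κ := Fintype.one_lt_card_iff_nontrivial.1 (by omega)
  have hGne : G ≠ 0 := by
    rintro rfl
    obtain ⟨x, hx⟩ := exists_ne (0 : κ → ℂ)
    obtain ⟨i, hi⟩ := hs x hx (by simp)
    simp at hi
  refine ⟨⟨{G, hessianDet G}, by rintro f (rfl | rfl) <;> exact ⟨_, ‹_›⟩,
    by ext; simp [hypersurface]⟩, ?_⟩
  have hcone : affineCone (hypersurface G ∩ hypersurface (hessianDet G)) =
      zeroLocus ℂ (Ideal.span {G, hessianDet G}) := by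
    rw [zeroLocus_span]
    ext v
    simp only [Set.mem_ofPred_eq, Set.mem_insert_iff, Set.mem_singleton_iff, forall_eq_or_imp,
      forall_eq]
    rw [← RingHom.coe_coe (aeval v), coe_aeval_eq_eval]
    by_cases hv : v = 0
    · subst hv
      -- The zero vector belongs to the affine cone only if the projective set is nonempty.
      obtain ⟨x, hx, h1, h2⟩ := exists_common_zero hG0 hH0 (by omega)
      refine iff_of_true ⟨Projectivization.mk ℂ x hx, ⟨?_, ?_⟩, zero_mem _⟩ ⟨hG0, hH0⟩
      · exact (eval_rep_mk_eq_zero_iff hG hx).2 h1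
      · exact (eval_rep_mk_eq_zero_iff hH hx).2 h2
    · rw [← eval_rep_mk_eq_zero_iff hG hv, ← eval_rep_mk_eq_zero_iff hH hv]
      constructor
      · rintro ⟨z, hz, hvz⟩
        have : Projectivization.mk ℂ v hv = z := by
          rw [← z.mk_rep, Projectivization.mk_eq_mk_iff']
          rw [Projectivization.submodule_eq] at hvz
          exact Submodule.mem_span_singleton.1 hvz
        rw [this]
        exact hz
      · intro h
        exact ⟨_, h, Submodule.mem_span_singleton_self v⟩
  -- The vanishing ideal of the cone is the radical of (G, Hess), and passing to the radical does
  -- not change the Krull dimension.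
  have hdim : ringKrullDim (CoordRing (hypersurface G ∩ hypersurface (hessianDet G))) =
      ringKrullDim (MvPolynomial κ ℂ ⧸ Ideal.span {G, hessianDet G}) := by
    unfold CoordRing
    rw [hcone, vanishingIdeal_zeroLocus_eq_radical, ringKrullDim_quotient,
      ringKrullDim_quotient, PrimeSpectrum.zeroLocus_radical]
  rw [hdim]
  have h1 := card_le_ringKrullDim_quotient_pair hG0 hH0
  have h2 := ringKrullDim_quotient_pair_add_two_le hGne fun f hf hfG =>
    hessianDet_notMem_span_of_prime_dvd hG hs hf hfG
  have h3 := le_antisymm h2 h1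
  rw [hd, show ((d + 3 : ℕ) : WithBot ℕ∞) = ((d + 1 : ℕ) : WithBot ℕ∞) + 2 by
    push_cast; rw [add_assoc]; norm_num] at h3
  have hbot : (2 : WithBot ℕ∞) ≠ ⊥ := WithBot.coe_ne_bot (a := (2 : ℕ∞))
  have htop : (2 : WithBot ℕ∞) ≠ ⊤ := fun h => ENat.natCast_ne_top 2 (WithBot.coe_injective h)
  exact le_antisymm ((WithBot.add_le_add_iff_right' hbot htop).1 h3.le)
    ((WithBot.add_le_add_iff_right' hbot htop).1 h3.ge)

/-! ### Normal forms along a line -/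

/-- Some vector outside `L`, tangent to `F = 0` along `L`, is orthogonal to all such vectors with
respect to all the quadratic forms `polar F u`, `u ∈ L`. -/
def IsDegenerateAlong (F : MvPolynomial ι ℂ) (L : Submodule ℂ (ι → ℂ)) : Prop :=
  ∃ r ∉ L, (∀ u ∈ L, polar F u u r = 0) ∧
    ∀ v, (∀ u ∈ L, polar F u u v = 0) → ∀ u ∈ L, polar F u r v = 0

theorem polar_eq_zero_of_forall_self {F : MvPolynomial ι ℂ} {L : Submodule ℂ (ι → ℂ)}
    {v : ι → ℂ} (h : ∀ u ∈ L, polar F u u v = 0) {u u' : ι → ℂ} (hu : u ∈ L) (hu' : u' ∈ L) :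
    polar F u u' v = 0 := by
  have h1 := h _ (add_mem hu hu')
  simp only [map_add, LinearMap.add_apply, h u hu, h u' hu'] at h1
  rw [polar_swap_left F u' u] at h1
  linear_combination h1 / 2

theorem polar_eq_zero_of_forall_cube {F : MvPolynomial ι ℂ} {L : Submodule ℂ (ι → ℂ)}
    (h : ∀ u ∈ L, polar F u u u = 0) {u v w : ι → ℂ} (hu : u ∈ L) (hv : v ∈ L) (hw : w ∈ L) :
    polar F u v w = 0 := by
  have h1 := polar_polarization F u v w
  rw [h _ (add_mem (add_mem hu hv) hw), h _ (add_mem hu hv), h _ (add_mem hu hw),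
    h _ (add_mem hv hw), h _ hu, h _ hv, h _ hw] at h1
  linear_combination h1 / 6

omit [Fintype ι] in
theorem eval_congr_of_mem_supported {s : Set ι} {f : MvPolynomial ι ℂ} (hf : f ∈ supported ℂ s)
    {x y : ι → ℂ} (hxy : ∀ i ∈ s, x i = y i) : eval x f = eval y f := by
  refine hom_congr_vars (f₁ := eval x) (f₂ := eval y) ?_ (fun i hi _ => ?_) rfl
  · ext; simp
  · simpa using hxy i (mem_supported.1 hf hi)

theorem cubic_coeff_eq_zero {a b c d : ℂ} (h : ∀ t : ℂ, a + b * t + c * t ^ 2 + d * t ^ 3 = 0) :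
    a = 0 ∧ b = 0 ∧ c = 0 := by
  have h0 := h 0
  have h1 := h 1
  have h2 := h (-1)
  have h3 := h 2
  refine ⟨by linear_combination h0, ?_, ?_⟩
  · linear_combination -1 / 2 * h0 + h1 - 1 / 3 * h2 - 1 / 6 * h3
  · linear_combination - h0 + h1 / 2 + h2 / 2

theorem mem_span_pair_basis_iff {n : ℕ} (e : Basis (Fin (n + 1)) ℂ (Fin (n + 1) → ℂ))
    {x : Fin (n + 1) → ℂ} :
    x ∈ Submodule.span ℂ {e 0, e 1} ↔ ∀ k, k ≠ 0 → k ≠ 1 → e.equivFun x k = 0 := by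
  rw [← Set.image_pair, e.mem_span_image]
  constructor
  · intro h k h0 h1
    by_contra hk
    rcases h (Finsupp.mem_support_iff.2 hk) with h | h
    · exact h0 h
    · exact h1 h
  · intro h k hk
    by_contra hne
    simp only [Set.mem_insert_iff, Set.mem_singleton_iff, not_or] at hne
    exact Finsupp.mem_support_iff.1 hk (h k hne.1 hne.2)

theorem fin_val_two {m : ℕ} : ((2 : Fin (m + 5)) : ℕ) = 2 :=
  Nat.mod_eq_of_lt (show 2 < m + 5 by omega)

theorem fin_val_three {m : ℕ} : ((3 : Fin (m + 5)) : ℕ) = 3 :=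
  Nat.mod_eq_of_lt (show 3 < m + 5 by omega)

theorem fin_val_four {m : ℕ} : ((4 : Fin (m + 5)) : ℕ) = 4 :=
  Nat.mod_eq_of_lt (show 4 < m + 5 by omega)

theorem fin_two_le_iff {m : ℕ} {k : Fin (m + 5)} : 2 ≤ k ↔ k ≠ 0 ∧ k ≠ 1 := by
  simp only [Fin.le_def, Ne, Fin.ext_iff, Fin.val_zero, Fin.val_one, fin_val_two]
  omega

theorem fin_four_le_iff {m : ℕ} {k : Fin (m + 5)} : 4 ≤ k ↔ k ≠ 0 ∧ k ≠ 1 ∧ k ≠ 2 ∧ k ≠ 3 := by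
  simp only [Fin.le_def, Ne, Fin.ext_iff, Fin.val_zero, Fin.val_one, fin_val_two, fin_val_three,
    fin_val_four]
  omega

theorem sum_Ici_four {m : ℕ} {f : Fin (m + 5) → ℂ} (hf : ∀ j, ¬ 4 ≤ j → f j = 0) :
    ∑ j ∈ Finset.Ici (2 : Fin (m + 5)), f j = ∑ j : Set.Ici (4 : Fin (m + 5)), f j := by
  rw [← Finset.sum_subtype (Finset.Ici (4 : Fin (m + 5))) (fun j => by simp) f]
  refine (Finset.sum_subset (fun j hj => ?_) fun j _ hj => hf j (by simpa using hj)).symm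
  rw [Finset.mem_Ici] at hj ⊢
  rw [fin_four_le_iff] at hj
  exact fin_two_le_iff.2 ⟨hj.1, hj.2.1⟩

/-! ### The trilinear form read off from the normal form. -/

section NormalForm

variable {m : ℕ} {E : MvPolynomial (Fin (m + 5)) ℂ}
  {ℓ : Fin (m + 5) → Fin (m + 5) → MvPolynomial (Fin (m + 5)) ℂ}
  {K : MvPolynomial (Fin (m + 5)) ℂ}

theorem polar_normalForm (hE : E.IsHomogeneous 3)
    (hℓ : ∀ i j, ℓ i j = ℓ j i ∧ (ℓ i j).IsHomogeneous 1 ∧ ℓ i j ∈ supported ℂ {0, 1})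
    (hK : K.IsHomogeneous 3) (hKs : K ∈ supported ℂ (Set.Ici 2))
    (h : E = X 2 * X 0 ^ 2 + X 3 * X 1 ^ 2 +
        (∑ i ∈ Finset.Ici (2 : Fin (m + 5)), ∑ j ∈ Finset.Ici (2 : Fin (m + 5)),
          X i * X j * ℓ i j) + K) {u : Fin (m + 5) → ℂ} (hu : ∀ k, 2 ≤ k → u k = 0) :
    polar E u u u = 0 ∧
    (∀ v : Fin (m + 5) → ℂ, v 0 = 0 → v 1 = 0 →
      3 * polar E u u v = v 2 * u 0 ^ 2 + v 3 * u 1 ^ 2) ∧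
    ∀ v w : Fin (m + 5) → ℂ, v 0 = 0 → v 1 = 0 → w 0 = 0 → w 1 = 0 →
      3 * polar E u v w = ∑ i ∈ Finset.Ici (2 : Fin (m + 5)),
        ∑ j ∈ Finset.Ici (2 : Fin (m + 5)), v i * w j * eval u (ℓ i j) := by
  have hu2 : u 2 = 0 := hu 2 le_rfl
  have hu3 : u 3 = 0 := hu 3 (by simp only [Fin.le_def, fin_val_two, fin_val_three]; omega)
  have key : ∀ v : Fin (m + 5) → ℂ, v 0 = 0 → v 1 = 0 →
      polar E u u u = 0 ∧ 3 * polar E u u v = v 2 * u 0 ^ 2 + v 3 * u 1 ^ 2 ∧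
      3 * polar E u v v = ∑ i ∈ Finset.Ici (2 : Fin (m + 5)),
        ∑ j ∈ Finset.Ici (2 : Fin (m + 5)), v i * v j * eval u (ℓ i j) := by
    intro v h0 h1
    set Q := ∑ i ∈ Finset.Ici (2 : Fin (m + 5)),
        ∑ j ∈ Finset.Ici (2 : Fin (m + 5)), v i * v j * eval u (ℓ i j) with hQ
    -- With u on the line and v in the complementary coordinate space, the summands of the normal
    -- form contribute exactly the powers t, t² and t³; comparison with the expansion of Φ at u + tv
    -- gives all three identities.
    have hev : ∀ t : ℂ, eval (u + t • v) E =
        t * (v 2 * u 0 ^ 2 + v 3 * u 1 ^ 2) + t ^ 2 * Q + t ^ 3 * eval v K := fun t => by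
      have hKe : eval (u + t • v) K = t ^ 3 * eval v K := by
        rw [← eval_smul_of_isHomogeneous hK]
        exact eval_congr_of_mem_supported hKs fun i hi => by simp [hu i hi]
      have hℓe : ∀ i j, eval (u + t • v) (ℓ i j) = eval u (ℓ i j) := fun i j =>
        eval_congr_of_mem_supported (hℓ i j).2.2 fun k hk => by
          rcases hk with rfl | rfl <;> simp [h0, h1]
      have hS : eval (u + t • v) (∑ i ∈ Finset.Ici (2 : Fin (m + 5)),
          ∑ j ∈ Finset.Ici (2 : Fin (m + 5)), X i * X j * ℓ i j) = t ^ 2 * Q := by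
        simp only [map_sum, map_mul, hℓe, eval_X, hQ, Finset.mul_sum]
        refine Finset.sum_congr rfl fun i hi => Finset.sum_congr rfl fun j hj => ?_
        simp only [Pi.add_apply, Pi.smul_apply, smul_eq_mul, hu i (Finset.mem_Ici.1 hi),
          hu j (Finset.mem_Ici.1 hj)]
        ring
      rw [h, map_add, map_add, hS, hKe]
      simp only [map_add, map_mul, map_pow, eval_X, Pi.add_apply, Pi.smul_apply, smul_eq_mul, h0,
        h1, hu2, hu3]
      ring
    obtain ⟨ha, hb, hc⟩ := cubic_coeff_eq_zero (a := polar E u u u)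
      (b := 3 * polar E u u v - (v 2 * u 0 ^ 2 + v 3 * u 1 ^ 2)) (c := 3 * polar E u v v - Q)
      (d := polar E v v v - eval v K) fun t => by
        have h2 := hev t
        rw [eval_eq_polar hE, polar_add_cube] at h2
        simp only [map_smul, LinearMap.smul_apply, smul_eq_mul] at h2
        linear_combination h2
    exact ⟨ha, sub_eq_zero.1 hb, sub_eq_zero.1 hc⟩
  refine ⟨(key 0 rfl rfl).1, fun v h0 h1 => (key v h0 h1).2.1, fun v w v0 v1 w0 w1 => ?_⟩
  have h1 := (key (v + w) (by simp [v0, w0]) (by simp [v1, w1])).2.2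
  have h2 := (key v v0 v1).2.2
  have h3 := (key w w0 w1).2.2
  have hsymm : ∑ i ∈ Finset.Ici (2 : Fin (m + 5)),
      ∑ j ∈ Finset.Ici (2 : Fin (m + 5)), w i * v j * eval u (ℓ i j) =
      ∑ i ∈ Finset.Ici (2 : Fin (m + 5)),
      ∑ j ∈ Finset.Ici (2 : Fin (m + 5)), v i * w j * eval u (ℓ i j) := by
    rw [Finset.sum_comm]
    refine Finset.sum_congr rfl fun i _ => Finset.sum_congr rfl fun j _ => ?_
    rw [(hℓ j i).1]
    ring
  simp only [Pi.add_apply, add_mul, mul_add, Finset.sum_add_distrib, map_add,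
    LinearMap.add_apply, hsymm] at h1
  rw [polar_swap_right E u w v] at h1
  linear_combination (h1 - h2 - h3) / 2

end NormalForm

/-- The coefficients of a column relation, extended by zero, are the coordinates of the required
vector r. -/
theorem IsHigherTripleLine.isDegenerateAlong {m : ℕ} {F : MvPolynomial (Fin (m + 4 + 1)) ℂ}
    (hF : F.IsHomogeneous 3) {L : Submodule ℂ (Fin (m + 4 + 1) → ℂ)}
    (hL : IsHigherTripleLine F L) : IsDegenerateAlong F L := by
  classical
  obtain ⟨-, e, ℓ, K, rfl, hℓ, hK, hKs, hE, hdep⟩ := hL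
  have hEh : (pullback (fun k => e k) F).IsHomogeneous 3 := isHomogeneous_pullback _ hF
  have hpol : ∀ x y z, polar F x y z =
      polar (pullback (fun k => e k) F) (e.equivFun x) (e.equivFun y) (e.equivFun z) := by
    intro x y z
    rw [polar_pullback _ hF, e.sum_equivFun, e.sum_equivFun, e.sum_equivFun]
  set E := pullback (fun k => e k) F
  have hnf := fun u (hu : u ∈ Submodule.span ℂ {e 0, e 1}) =>
    polar_normalForm (u := e.equivFun u) hEh hℓ hK hKs hE fun k hk =>
      (mem_span_pair_basis_iff e).1 hu k (fin_two_le_iff.1 hk).1 (fin_two_le_iff.1 hk).2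
  have hcube : ∀ u ∈ Submodule.span ℂ {e 0, e 1}, polar F u u u = 0 := fun u hu => by
    rw [hpol]
    exact (hnf u hu).1
  obtain ⟨c, hc, j₀, hj₀⟩ := Fintype.not_linearIndependent_iff.1 hdep
  let rc : Fin (m + 4 + 1) → ℂ := fun k => if hk : k ∈ Set.Ici 4 then c ⟨k, hk⟩ else 0
  have hrc : e.equivFun (e.equivFun.symm rc) = rc := LinearEquiv.apply_symm_apply _ _
  have hrc0 : ∀ k, ¬ 4 ≤ k → rc k = 0 := fun k hk => dif_neg hk
  have hr0 : rc 0 = 0 := hrc0 0 fun h => (fin_four_le_iff.1 h).1 rfl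
  have hr1 : rc 1 = 0 := hrc0 1 fun h => (fin_four_le_iff.1 h).2.1 rfl
  have hr2 : rc 2 = 0 := hrc0 2 fun h => (fin_four_le_iff.1 h).2.2.1 rfl
  have hr3 : rc 3 = 0 := hrc0 3 fun h => (fin_four_le_iff.1 h).2.2.2 rfl
  have hur : ∀ u ∈ Submodule.span ℂ {e 0, e 1}, polar F u u (e.equivFun.symm rc) = 0 := by
    intro u hu
    have := (hnf u hu).2.1 rc hr0 hr1
    rw [hpol, hrc]
    rw [hr2, hr3] at this
    linear_combination this / 3
  refine ⟨e.equivFun.symm rc, fun hr => ?_, hur, fun v hv u hu => ?_⟩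
  · have h4 := fin_four_le_iff.1 j₀.2
    have := (mem_span_pair_basis_iff e).1 hr j₀ h4.1 h4.2.1
    rw [hrc] at this
    exact hj₀ ((dif_pos j₀.2).symm.trans this)
  · have h01 : (0 : Fin (m + 4 + 1)) ≠ 1 := by rw [Ne, Fin.ext_iff]; simp
    -- The part of v in L pairs trivially with r. The remainder v₂ is tangent along L, and testing
    -- at e₀ and e₁ shows that its coordinates 2 and 3 vanish, so only the block of indices at least
    -- 4 matters.
    set v₁ := e.equivFun v 0 • e 0 + e.equivFun v 1 • e 1 with hv₁
    have hv₁L : v₁ ∈ Submodule.span ℂ {e 0, e 1} := Submodule.mem_span_pair.2 ⟨_, _, rfl⟩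
    obtain ⟨v₂, hv₂⟩ : ∃ v₂, v = v₁ + v₂ := ⟨v - v₁, by abel⟩
    have hv₂c : e.equivFun v₂ = e.equivFun v - e.equivFun v₁ := by
      rw [hv₂, map_add, add_sub_cancel_left]
    have h0 : e.equivFun v₂ 0 = 0 := by
      simp [hv₂c, hv₁, h01]
    have h1 : e.equivFun v₂ 1 = 0 := by
      simp [hv₂c, hv₁, h01.symm]
    have huv₂ : ∀ u ∈ Submodule.span ℂ {e 0, e 1}, polar F u u v₂ = 0 := fun u hu => by
      have := hv u hu
      rwa [hv₂, map_add, polar_eq_zero_of_forall_cube hcube hu hu hv₁L, zero_add] at this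
    have h2 : e.equivFun v₂ 2 = 0 := by
      have hm : e 0 ∈ Submodule.span ℂ {e 0, e 1} := Submodule.subset_span (by simp)
      have h := (hnf _ hm).2.1 _ h0 h1
      rw [← hpol, huv₂ _ hm] at h
      simpa [Finsupp.single_apply, h01] using h.symm
    have h3 : e.equivFun v₂ 3 = 0 := by
      have hm : e 1 ∈ Submodule.span ℂ {e 0, e 1} := Submodule.subset_span (by simp)
      have h := (hnf _ hm).2.1 _ h0 h1
      rw [← hpol, huv₂ _ hm] at h
      simpa [Finsupp.single_apply, h01.symm] using h.symm
    rw [hv₂, map_add, polar_swap_right, polar_eq_zero_of_forall_self hur hu hv₁L, zero_add]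
    have h := (hnf u hu).2.2 (e.equivFun v₂) rc h0 h1 hr0 hr1
    have hsum : ∀ i ∈ Finset.Ici (2 : Fin (m + 5)), ∑ j ∈ Finset.Ici (2 : Fin (m + 5)),
        e.equivFun v₂ i * rc j * eval (e.equivFun u) (ℓ i j) = 0 := by
      intro i _
      by_cases hi : 4 ≤ i
      · have hci := congrArg (eval (e.equivFun u)) (congrFun hc ⟨i, hi⟩)
        simp only [Finset.sum_apply, Pi.smul_apply, map_sum, smul_eval, Pi.zero_apply,
          map_zero] at hci
        simp only [mul_assoc, ← Finset.mul_sum]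
        rw [mul_eq_zero]
        right
        rw [← hci]
        rw [sum_Ici_four fun j hj => by rw [hrc0 j hj, zero_mul]]
        exact Finset.sum_congr rfl fun j _ => by rw [show rc j = c j from dif_pos j.2]
      · have : e.equivFun v₂ i = 0 := by
          rw [fin_four_le_iff] at hi
          by_cases i0 : i = 0
          · rwa [i0]
          by_cases i1 : i = 1
          · rwa [i1]
          by_cases i2 : i = 2
          · rwa [i2]
          by_cases i3 : i = 3
          · rwa [i3]
          exact absurd ⟨i0, i1, i2, i3⟩ hi
        simp [this]
    rw [Finset.sum_eq_zero hsum] at h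
    rw [polar_swap_right, hpol, hrc]
    linear_combination h / 3

/-- The factors 3 are multinomial: the coefficient of x₀²xⱼ in the new coordinates is 3Φ(e₀,e₀,eⱼ).
The condition on Φ(e₀,e₁,·) removes the mixed terms x₀x₁xⱼ. -/
theorem pullback_eq_normalForm {m : ℕ} {F : MvPolynomial (Fin (m + 5)) ℂ}
    (hF : F.IsHomogeneous 3) (e : Fin (m + 5) → Fin (m + 5) → ℂ)
    (h0 : ∀ j, 3 * polar F (e 0) (e 0) (e j) = if j = 2 then 1 else 0)
    (h1 : ∀ j, 3 * polar F (e 1) (e 1) (e j) = if j = 3 then 1 else 0)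
    (h01 : ∀ j, polar F (e 0) (e 1) (e j) = 0) :
    pullback e F = X 2 * X 0 ^ 2 + X 3 * X 1 ^ 2 +
        (∑ i ∈ Finset.Ici (2 : Fin (m + 5)), ∑ j ∈ Finset.Ici (2 : Fin (m + 5)),
          X i * X j * (C (3 * polar F (e 0) (e i) (e j)) * X 0 +
            C (3 * polar F (e 1) (e i) (e j)) * X 1)) +
        ∑ i ∈ Finset.Ici (2 : Fin (m + 5)), ∑ j ∈ Finset.Ici (2 : Fin (m + 5)),
          ∑ k ∈ Finset.Ici (2 : Fin (m + 5)), C (polar F (e i) (e j) (e k)) * (X i * X j * X k) := by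
  have hsplit : ∀ f : Fin (m + 5) → Fin (m + 5) → ℂ,
      ∑ k, f k = f 0 + f 1 + ∑ k ∈ Finset.Ici (2 : Fin (m + 5)), f k := by
    intro f
    have hs : (Finset.univ : Finset (Fin (m + 5))) =
        insert 0 (insert 1 (Finset.Ici (2 : Fin (m + 5)))) := by
      ext k
      simp only [Finset.mem_univ, Finset.mem_insert, Finset.mem_Ici, fin_two_le_iff, true_iff]
      tauto
    rw [hs, Finset.sum_insert, Finset.sum_insert, add_assoc]
    · simp only [Finset.mem_Ici, fin_two_le_iff]
      simp
    · simp only [Finset.mem_insert, Finset.mem_Ici, fin_two_le_iff]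
      simp
  refine MvPolynomial.funext fun y => ?_
  rw [eval_pullback, eval_eq_polar hF, hsplit, polar_add_cube]
  set u := y 0 • e 0 + y 1 • e 1 with hu
  set v := ∑ k ∈ Finset.Ici (2 : Fin (m + 5)), y k • e k with hv
  have huu : ∀ j, 3 * polar F u u (e j) =
      (if j = 2 then y 0 ^ 2 else 0) + if j = 3 then y 1 ^ 2 else 0 := fun j => by
    simp only [hu, map_add, LinearMap.add_apply, map_smul, LinearMap.smul_apply, smul_eq_mul]
    rw [polar_swap_left F (e 1) (e 0), h01]
    have e0 := h0 j
    have e1 := h1 j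
    split_ifs at * <;> linear_combination y 0 ^ 2 * e0 + y 1 ^ 2 * e1
  have hne : ∀ a b : Fin (m + 5), (a : ℕ) ≠ b → a ≠ b := fun a b h hab => h (congrArg _ hab)
  have huuu : polar F u u u = 0 := by
    have a0 := huu 0
    have a1 := huu 1
    rw [if_neg (hne _ _ (by rw [fin_val_two]; simp)), if_neg (hne _ _ (by rw [fin_val_three]; simp))] at a0
    rw [if_neg (hne _ _ (by rw [fin_val_two]; simp)), if_neg (hne _ _ (by rw [fin_val_three]; simp))] at a1
    conv_lhs => rw [hu]
    rw [map_add, map_smul, map_smul, smul_eq_mul, smul_eq_mul]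
    linear_combination (y 0 * a0 + y 1 * a1) / 3
  have huuv : 3 * polar F u u v = y 2 * y 0 ^ 2 + y 3 * y 1 ^ 2 := by
    rw [hv, map_sum, Finset.mul_sum]
    simp only [map_smul, smul_eq_mul, mul_left_comm (3 : ℂ), huu, mul_add, Finset.sum_add_distrib,
      mul_ite, mul_zero, Finset.sum_ite_eq', Finset.mem_Ici, Fin.le_def, fin_val_two, fin_val_three]
    simp
  have huvv : 3 * polar F u v v = ∑ i ∈ Finset.Ici (2 : Fin (m + 5)),
      ∑ j ∈ Finset.Ici (2 : Fin (m + 5)), y i * y j * (3 * polar F (e 0) (e i) (e j) * y 0 +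
        3 * polar F (e 1) (e i) (e j) * y 1) := by
    simp only [hu, hv, map_sum, LinearMap.sum_apply, map_add, LinearMap.add_apply, map_smul,
      LinearMap.smul_apply, smul_eq_mul, Finset.mul_sum]
    rw [Finset.sum_comm]
    refine Finset.sum_congr rfl fun i _ => Finset.sum_congr rfl fun j _ => by ring
  have hvvv : polar F v v v = ∑ i ∈ Finset.Ici (2 : Fin (m + 5)),
      ∑ j ∈ Finset.Ici (2 : Fin (m + 5)), ∑ k ∈ Finset.Ici (2 : Fin (m + 5)),
        polar F (e i) (e j) (e k) * (y i * y j * y k) := by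
    have e1 : ∀ x z, polar F v x z =
        ∑ i ∈ Finset.Ici (2 : Fin (m + 5)), y i * polar F (e i) x z := fun x z => by
      simp only [hv, map_sum, LinearMap.sum_apply, map_smul, LinearMap.smul_apply, smul_eq_mul]
    rw [e1]
    refine Finset.sum_congr rfl fun i _ => ?_
    rw [polar_swap_left, e1, Finset.mul_sum]
    refine Finset.sum_congr rfl fun j _ => ?_
    rw [polar_swap_right, polar_swap_left, e1, Finset.mul_sum, Finset.mul_sum]
    refine Finset.sum_congr rfl fun k _ => ?_
    rw [polar_swap_left, polar_swap_right, polar_swap_left F (e j)]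
    rw [polar_swap_right]
    ring
  rw [huuu, huuv, huvv, hvvv]
  simp only [map_add, map_mul, map_sum, map_pow, eval_X, eval_C, zero_add]

/-- Tangency of r at e₀ and e₁ gives r₂ = r₃ = 0, so the remaining coordinates outside L give a
column relation; it is nontrivial because r is not in L. -/
theorem isHigherTripleLine_of_basis {m : ℕ} {F : MvPolynomial (Fin (m + 4 + 1)) ℂ}
    (hF : F.IsHomogeneous 3) {L : Submodule ℂ (Fin (m + 4 + 1) → ℂ)} (hL : IsSecondType F L)
    (hd : IsDegenerateAlong F L)
    (e : Basis (Fin (m + 4 + 1)) ℂ (Fin (m + 4 + 1) → ℂ)) (he : L = Submodule.span ℂ {e 0, e 1})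
    (h0 : ∀ j, 3 * polar F (e 0) (e 0) (e j) = if j = 2 then 1 else 0)
    (h1 : ∀ j, 3 * polar F (e 1) (e 1) (e j) = if j = 3 then 1 else 0)
    (h01 : ∀ j, polar F (e 0) (e 1) (e j) = 0) : IsHigherTripleLine F L := by
  have hX0 : (X 0 : MvPolynomial (Fin (m + 5)) ℂ) ∈ supported ℂ {0, 1} :=
    X_mem_supported.2 (by simp)
  have hX1 : (X 1 : MvPolynomial (Fin (m + 5)) ℂ) ∈ supported ℂ {0, 1} :=
    X_mem_supported.2 (by simp)
  have hC : ∀ (s : Set (Fin (m + 5))) (c : ℂ), C c ∈ supported ℂ s := fun s c =>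
    (supported ℂ s).algebraMap_mem c
  refine ⟨hL, e, _, _, he, fun i j => ⟨?_, ?_, ?_⟩, ?_, ?_,
    pullback_eq_normalForm hF (fun k => e k) h0 h1 h01, ?_⟩
  · rw [polar_swap_right F _ (e i), polar_swap_right F _ (e i)]
  · exact ((isHomogeneous_X ℂ _).C_mul _).add ((isHomogeneous_X ℂ _).C_mul _)
  · exact add_mem (mul_mem (hC _ _) hX0) (mul_mem (hC _ _) hX1)
  · exact IsHomogeneous.sum _ _ _ fun i _ => IsHomogeneous.sum _ _ _ fun j _ =>
      IsHomogeneous.sum _ _ _ fun k _ =>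
        (((isHomogeneous_X ℂ _).mul (isHomogeneous_X ℂ _)).mul (isHomogeneous_X ℂ _)).C_mul _
  · have hX : ∀ i ∈ Finset.Ici (2 : Fin (m + 5)),
        (X i : MvPolynomial (Fin (m + 5)) ℂ) ∈ supported ℂ (Set.Ici 2) := fun i hi =>
      X_mem_supported.2 (Finset.mem_Ici.1 hi)
    exact sum_mem fun i hi => sum_mem fun j hj => sum_mem fun k hk =>
      mul_mem (hC _ _) (mul_mem (mul_mem (hX i hi) (hX j hj)) (hX k hk))
  · obtain ⟨r, hrL, hr, hd⟩ := hd
    subst he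
    have he0 : e 0 ∈ Submodule.span ℂ {e 0, e 1} := Submodule.subset_span (by simp)
    have he1 : e 1 ∈ Submodule.span ℂ {e 0, e 1} := Submodule.subset_span (by simp)
    have hexp : ∀ x y, polar F x y r = ∑ k, e.equivFun r k * polar F x y (e k) := fun x y => by
      conv_lhs => rw [← e.sum_equivFun r]
      simp only [map_sum, map_smul, smul_eq_mul]
    have hr2 : e.equivFun r 2 = 0 := by
      have h := hr _ he0
      rw [hexp] at h
      have h' := congrArg (3 * ·) h
      simpa only [Finset.mul_sum, mul_left_comm (3 : ℂ), h0, mul_ite, mul_one, mul_zero,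
        Finset.sum_ite_eq', Finset.mem_univ, if_true] using h'
    have hr3 : e.equivFun r 3 = 0 := by
      have h := hr _ he1
      rw [hexp] at h
      have h' := congrArg (3 * ·) h
      simpa only [Finset.mul_sum, mul_left_comm (3 : ℂ), h1, mul_ite, mul_one, mul_zero,
        Finset.sum_ite_eq', Finset.mem_univ, if_true] using h'
    have hP : ∀ i, 4 ≤ i → polar F (e 0) (e 0) (e i) = 0 ∧ polar F (e 1) (e 1) (e i) = 0 := by
      intro i hi
      have hi' := fin_four_le_iff.1 hi
      have a0 := h0 i
      have a1 := h1 i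
      rw [if_neg hi'.2.2.1] at a0
      rw [if_neg hi'.2.2.2] at a1
      exact ⟨by linear_combination a0 / 3, by linear_combination a1 / 3⟩
    have hPL : ∀ i, 4 ≤ i → ∀ u ∈ Submodule.span ℂ {e 0, e 1}, polar F u u (e i) = 0 := by
      intro i hi u hu
      obtain ⟨a, b, rfl⟩ := Submodule.mem_span_pair.1 hu
      simp only [map_add, LinearMap.add_apply, map_smul, LinearMap.smul_apply, smul_eq_mul,
        (hP i hi).1, (hP i hi).2, h01]
      rw [polar_swap_left, h01]
      ring
    have hsum : ∀ i, 4 ≤ i → ∀ u, u = e 0 ∨ u = e 1 →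
        ∑ j : Set.Ici (4 : Fin (m + 5)), e.equivFun r j * polar F u (e i) (e j) = 0 := by
      intro i hi u hu
      have huL : u ∈ Submodule.span ℂ {e 0, e 1} := by
        rcases hu with rfl | rfl
        exacts [he0, he1]
      have h := hd _ (hPL i hi) u huL
      rw [polar_swap_right, hexp] at h
      rw [← h, ← Finset.sum_subtype (Finset.Ici (4 : Fin (m + 5))) (fun j => by simp)
        (fun j => e.equivFun r j * polar F u (e i) (e j))]
      refine Finset.sum_subset (Finset.subset_univ _) fun j _ hj => ?_
      rw [Finset.mem_Ici, fin_four_le_iff] at hj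
      by_cases j0 : j = 0
      · rw [j0, polar_swap_right, polar_eq_zero_of_forall_self (hPL i hi) huL he0, mul_zero]
      by_cases j1 : j = 1
      · rw [j1, polar_swap_right, polar_eq_zero_of_forall_self (hPL i hi) huL he1, mul_zero]
      by_cases j2 : j = 2
      · rw [j2, hr2, zero_mul]
      by_cases j3 : j = 3
      · rw [j3, hr3, zero_mul]
      exact absurd ⟨j0, j1, j2, j3⟩ hj
    rw [Fintype.not_linearIndependent_iff]
    refine ⟨fun j => e.equivFun r j, ?_, ?_⟩
    · ext1 i
      simp only [Finset.sum_apply, Pi.smul_apply, Pi.zero_apply, smul_add, smul_eq_C_mul,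
        ← mul_assoc, ← C_mul, Finset.sum_add_distrib, ← Finset.sum_mul, ← map_sum]
      have a0 := hsum i i.2 (e 0) (Or.inl rfl)
      have a1 := hsum i i.2 (e 1) (Or.inr rfl)
      simp only [mul_comm _ (3 : ℂ), mul_assoc, ← Finset.mul_sum, a0, a1]
      simp
    · by_contra! hall
      refine hrL ((mem_span_pair_basis_iff e).2 fun k k0 k1 => ?_)
      by_cases k2 : k = 2
      · rw [k2, hr2]
      by_cases k3 : k = 3
      · rw [k3, hr3]
      exact hall ⟨k, fin_four_le_iff.2 ⟨k0, k1, k2, k3⟩⟩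

/-! ### Bases adapted to a line and two linear forms. -/

theorem finrank_ker_inf_ker {V : Type*} [AddCommGroup V] [Module ℂ V] [FiniteDimensional ℂ V]
    {α β : V →ₗ[ℂ] ℂ} {v w : V} (hαv : α v = 1) (hβv : β v = 0) (hαw : α w = 0) (hβw : β w = 1) :
    finrank ℂ ↥(LinearMap.ker α ⊓ LinearMap.ker β) + 2 = finrank ℂ V := by
  have hsurj : Function.Surjective (α.prod β) := fun ⟨a, b⟩ =>
    ⟨a • v + b • w, by simp [hαv, hβv, hαw, hβw]⟩
  rw [← LinearMap.ker_prod, add_comm, ← (α.prod β).finrank_range_add_finrank_ker,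
    LinearMap.range_eq_top.2 hsurj, finrank_top, finrank_prod, finrank_self]

/-- The forms α and β become the coordinates x₂ and x₃ up to the choice of basis: p, q are completed
inside ker α ∩ ker β, and v, w are the vectors dual to α, β. -/
theorem exists_basis_of_dual_pair {m : ℕ} {V : Type*} [AddCommGroup V] [Module ℂ V]
    [FiniteDimensional ℂ V] (hV : finrank ℂ V = m + 5) {α β : V →ₗ[ℂ] ℂ} {p q v w : V}
    (hαv : α v = 1) (hβv : β v = 0) (hαw : α w = 0) (hβw : β w = 1)
    (hαp : α p = 0) (hβp : β p = 0) (hαq : α q = 0) (hβq : β q = 0)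
    (hpq : LinearIndependent ℂ ![p, q]) :
    ∃ e : Basis (Fin (m + 5)) ℂ V, e 0 = p ∧ e 1 = q ∧
      (∀ j, α (e j) = if j = 2 then 1 else 0) ∧ ∀ j, β (e j) = if j = 3 then 1 else 0 := by
  have hP := finrank_ker_inf_ker hαv hβv hαw hβw
  set P := LinearMap.ker α ⊓ LinearMap.ker β
  let p' : P := ⟨p, hαp, hβp⟩
  let q' : P := ⟨q, hαq, hβq⟩
  have hpq' : LinearIndependent ℂ ![p', q'] := by
    refine LinearIndependent.of_comp P.subtype ?_
    convert hpq using 1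
    ext i
    fin_cases i <;> rfl
  obtain ⟨Q, hQ⟩ := (Submodule.span ℂ (Set.range ![p', q'])).exists_isCompl
  have hQr : finrank ℂ Q = m + 1 := by
    have h1 := Submodule.finrank_add_eq_of_isCompl hQ
    rw [finrank_span_eq_card hpq', Fintype.card_fin] at h1
    omega
  let f := (finBasisOfFinrankEq ℂ Q hQr)
  let g : Fin (m + 5) → V := Fin.cons p (Fin.cons q (Fin.cons v (Fin.cons w
    fun i => ((f i : P) : V))))
  have h1 : (1 : Fin (m + 5)) = Fin.succ 0 := by simp
  have h2 : (2 : Fin (m + 5)) = Fin.succ (Fin.succ 0) := Fin.ext (by rw [fin_val_two]; rfl)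
  have h3 : (3 : Fin (m + 5)) = Fin.succ (Fin.succ (Fin.succ 0)) :=
    Fin.ext (by rw [fin_val_three]; rfl)
  have hαg : ∀ j, α (g j) = if j = 2 then 1 else 0 := by
    rw [h2]
    simp only [Fin.forall_fin_succ (n := m + 4), Fin.forall_fin_succ (n := m + 3),
      Fin.forall_fin_succ (n := m + 2), Fin.forall_fin_succ (n := m + 1), g, Fin.cons_zero,
      Fin.cons_succ, Fin.succ_inj]
    refine ⟨?_, ?_, ?_, ?_, fun i => ?_⟩
    · rwa [if_neg (Fin.succ_ne_zero _).symm]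
    · simpa using hαq
    · simpa using hαv
    · simpa using hαw
    · simpa using (f i : P).2.1
  have hβg : ∀ j, β (g j) = if j = 3 then 1 else 0 := by
    rw [h3]
    simp only [Fin.forall_fin_succ (n := m + 4), Fin.forall_fin_succ (n := m + 3),
      Fin.forall_fin_succ (n := m + 2), Fin.forall_fin_succ (n := m + 1), g, Fin.cons_zero,
      Fin.cons_succ, Fin.succ_inj]
    refine ⟨?_, ?_, ?_, ?_, fun i => ?_⟩
    · rwa [if_neg (Fin.succ_ne_zero _).symm]
    · rwa [if_neg (Fin.succ_ne_zero _).symm]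
    · simpa using hβv
    · simpa using hβw
    · simpa using (f i : P).2.2
  have hlin : LinearIndependent ℂ g := by
    rw [Fintype.linearIndependent_iff]
    intro c hc
    have c2 : c 2 = 0 := by
      have := congrArg α hc
      simpa [map_sum, hαg] using this
    have c3 : c 3 = 0 := by
      have := congrArg β hc
      simpa [map_sum, hβg] using this
    rw [h2] at c2
    rw [h3] at c3
    simp only [Fin.sum_univ_succ (n := m + 4), Fin.sum_univ_succ (n := m + 3),
      Fin.sum_univ_succ (n := m + 2), Fin.sum_univ_succ (n := m + 1), g, Fin.cons_zero,
      Fin.cons_succ, c2, c3, zero_smul, zero_add] at hc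
    have hc' : (c 0 • p' + c (Fin.succ 0) • q') +
        ((∑ i, c i.succ.succ.succ.succ • f i : Q) : P) = 0 := by
      refine Subtype.ext ?_
      simpa [p', q', add_assoc] using hc
    have hL : c 0 • p' + c (Fin.succ 0) • q' ∈ Submodule.span ℂ (Set.range ![p', q']) := by
      rw [Matrix.range_cons, Matrix.range_cons, Matrix.range_empty, Set.union_empty]
      exact Submodule.mem_span_pair.2 ⟨_, _, rfl⟩
    have hz := Submodule.disjoint_def.1 hQ.disjoint _ hL (by
      rw [eq_neg_of_add_eq_zero_left hc']
      exact neg_mem (Subtype.property _))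
    rw [hz, zero_add] at hc'
    have hpq0 := LinearIndependent.pair_iff.1 hpq' _ _ hz
    have hf := Fintype.linearIndependent_iff.1 f.linearIndependent _ (Subtype.ext hc')
    simp only [Fin.forall_fin_succ (n := m + 4), Fin.forall_fin_succ (n := m + 3),
      Fin.forall_fin_succ (n := m + 2), Fin.forall_fin_succ (n := m + 1)]
    exact ⟨hpq0.1, hpq0.2, c2, c3, hf⟩
  let e := basisOfLinearIndependentOfCardEqFinrank hlin (by rw [hV, Fintype.card_fin])
  have he : ∀ j, e j = g j := fun j => by
    rw [coe_basisOfLinearIndependentOfCardEqFinrank]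
  refine ⟨e, he 0, ?_, fun j => by rw [he, hαg], fun j => by rw [he, hβg]⟩
  rw [he, h1]
  rfl

/-! ### Cubics with an Eckardt point -/

/-- The tangent hyperplane of the cubic at `p` is spanned by `p` and the image of the injective
map `s`, which does not contain `p`, and the form `polar F p` vanishes on it. -/
structure IsEckardtSplitting (F : MvPolynomial ι ℂ) (p : ι → ℂ) (s : (κ → ℂ) →ₗ[ℂ] ι → ℂ) :
    Prop where
  ne_zero : polar F p p ≠ 0
  self : polar F p p p = 0
  map : ∀ y, polar F p p (s y) = 0
  orth : ∀ v w, polar F p p v = 0 → polar F p p w = 0 → polar F p v w = 0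
  exists_eq : ∀ v, polar F p p v = 0 → ∃ (a : ℂ) (y : κ → ℂ), v = a • p + s y
  eq_zero : ∀ (a : ℂ) y, a • p + s y = 0 → a = 0 ∧ y = 0

theorem exists_apply_eq_one {V : Type*} [AddCommGroup V] [Module ℂ V] {α : V →ₗ[ℂ] ℂ}
    (h : α ≠ 0) : ∃ v, α v = 1 := by
  obtain ⟨v, hv⟩ : ∃ v, α v ≠ 0 := by
    by_contra! hall
    exact h (LinearMap.ext hall)
  exact ⟨(α v)⁻¹ • v, by rw [map_smul, smul_eq_mul, inv_mul_cancel₀ hv]⟩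

theorem isEckardtSplitting {F : MvPolynomial ι ℂ} (hF : F.IsHomogeneous 3) (hX : IsSmoothForm F)
    {p : ℙ ℂ (ι → ℂ)} (hp : IsEckardtPoint F p) {b : κ → ι → ℂ} (hb : LinearIndependent ℂ b)
    (hbT : ∀ k, b k ∈ tangentSpace F p.rep)
    (hbp : Disjoint p.submodule (Submodule.span ℂ (Set.range b)))
    (hcard : Fintype.card κ + 2 = Fintype.card ι) :
    IsEckardtSplitting F p.rep (Fintype.linearCombination ℂ b) := by
  have hne : polar F p.rep p.rep ≠ 0 := fun h =>
    p.rep_nonzero ((isSmoothForm_iff hF).1 hX _ h)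
  have hself : polar F p.rep p.rep p.rep = 0 := by
    rw [← eval_eq_polar hF]
    exact hp.1
  have hrange : LinearMap.range (Fintype.linearCombination ℂ b) =
      Submodule.span ℂ (Set.range b) := Fintype.range_linearCombination ℂ b
  have hle : Submodule.span ℂ (Set.range b) ≤ LinearMap.ker (polar F p.rep p.rep) := by
    rw [← tangentSpace_eq_ker hF, Submodule.span_le]
    rintro _ ⟨k, rfl⟩
    exact hbT k
  have hsup : p.submodule ⊔ Submodule.span ℂ (Set.range b) =
      LinearMap.ker (polar F p.rep p.rep) := by
    refine Submodule.eq_of_le_of_finrank_eq (sup_le ?_ hle) ?_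
    · rw [Projectivization.submodule_eq, Submodule.span_singleton_le_iff_mem]
      exact hself
    · have h1 := Submodule.finrank_sup_add_finrank_inf_eq p.submodule
        (Submodule.span ℂ (Set.range b))
      rw [hbp.eq_bot, finrank_bot, p.finrank_submodule, finrank_span_eq_card hb] at h1
      have h2 := Module.Dual.finrank_ker_add_one_of_ne_zero hne
      rw [finrank_fintype_fun_eq_card] at h2
      omega
  refine ⟨hne, hself, fun y => hle (hrange ▸ LinearMap.mem_range_self _ y), fun v w hv hw =>
    hp.polar_eq_zero hF ((mem_tangentSpace hF).2 hv) ((mem_tangentSpace hF).2 hw), fun v hv => ?_,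
    fun a y h => ?_⟩
  · have hv' : v ∈ p.submodule ⊔ Submodule.span ℂ (Set.range b) := hsup ▸ hv
    rw [← hrange, Projectivization.submodule_eq] at hv'
    obtain ⟨x, hx, _, ⟨y, rfl⟩, rfl⟩ := Submodule.mem_sup.1 hv'
    obtain ⟨a, rfl⟩ := Submodule.mem_span_singleton.1 hx
    exact ⟨a, y, rfl⟩
  · have hy : a • p.rep ∈ Submodule.span ℂ (Set.range b) := by
      rw [eq_neg_of_add_eq_zero_left h, ← hrange]
      exact neg_mem (LinearMap.mem_range_self _ y)
    have ha := Submodule.disjoint_def.1 hbp (a • p.rep) (by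
      rw [Projectivization.submodule_eq]
      exact Submodule.smul_mem _ _ (Submodule.mem_span_singleton_self _)) hy
    refine ⟨(smul_eq_zero.1 ha).resolve_right p.rep_nonzero, ?_⟩
    rw [ha, zero_add, Fintype.linearCombination_apply] at h
    exact funext (Fintype.linearIndependent_iff.1 hb y h)

namespace IsEckardtSplitting

variable {F : MvPolynomial ι ℂ} {p : ι → ℂ} {s : (κ → ℂ) →ₗ[ℂ] ι → ℂ} {G : MvPolynomial κ ℂ}

omit [Fintype κ] in
theorem polar_section (h : IsEckardtSplitting F p s) {v w : ι → ℂ} (hv : polar F p p v = 0)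
    (hw : polar F p p w = 0) : polar F v p w = 0 := by
  rw [polar_swap_left, h.orth v w hv hw]

theorem polar_combination (h : IsEckardtSplitting F p s)
    (hG : ∀ x y z, polar G x y z = polar F (s x) (s y) (s z)) (a b c : ℂ) (x y z : κ → ℂ) :
    polar F (a • p + s x) (b • p + s y) (c • p + s z) = polar G x y z := by
  have h1 : ∀ x z, polar F (s x) p (s z) = 0 := fun x z => h.polar_section (h.map x) (h.map z)
  have h2 : ∀ x, polar F (s x) p p = 0 := fun x => h.polar_section (h.map x) h.self
  have h3 : ∀ x y, polar F (s x) (s y) p = 0 := fun x y => by rw [polar_swap_right, h1]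
  simp only [map_add, map_smul, LinearMap.add_apply, LinearMap.smul_apply, smul_eq_mul, h.self,
    h.map, h.orth _ _ (h.map _) h.self, h.orth _ _ (h.map _) (h.map _), h1, h2, h3,
    hG]
  ring

/-- Let y be singular on Y and Φ(p,p,e) = 1. Every tp + s(y) is orthogonal to T in the sense of
Φ(x,x,·), so it is singular on X as soon as the quadratic Φ(x,x,e) in t vanishes at it; its leading
coefficient is 1, so a root exists. -/
theorem isSmoothForm (h : IsEckardtSplitting F p s) (hF : F.IsHomogeneous 3)
    (hX : IsSmoothForm F) (hGh : G.IsHomogeneous 3)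
    (hG : ∀ x y z, polar G x y z = polar F (s x) (s y) (s z)) : IsSmoothForm G := by
  rw [isSmoothForm_iff hF] at hX
  rw [isSmoothForm_iff hGh]
  intro y hy
  obtain ⟨e, he⟩ := exists_apply_eq_one h.ne_zero
  obtain ⟨d, hd⟩ := IsAlgClosed.exists_eq_mul_self
    (discrim (polar F p p e) (2 * polar F p (s y) e) (polar F (s y) (s y) e))
  obtain ⟨t, ht⟩ := exists_quadratic_eq_zero (he ▸ one_ne_zero) ⟨d, hd⟩
  refine (h.eq_zero t y (hX _ (LinearMap.ext fun v => ?_))).2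
  obtain ⟨a, z, haz⟩ := h.exists_eq (v - polar F p p v • e) (by
    rw [map_sub, map_smul, he, smul_eq_mul, mul_one, sub_self])
  rw [sub_eq_iff_eq_add.1 haz, map_add, h.polar_combination hG, hy, map_smul]
  simp only [map_add, map_smul, LinearMap.add_apply, LinearMap.smul_apply, smul_eq_mul,
    LinearMap.zero_apply, polar_swap_left F (s y) p]
  linear_combination (polar F p p v) * ht

omit [Fintype κ] in
theorem mem_span_pair_iff (h : IsEckardtSplitting F p s) {a : ℂ} {y z : κ → ℂ} :
    a • p + s z ∈ Submodule.span ℂ {p, s y} ↔ ∃ c : ℂ, c • y = z := by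
  rw [Submodule.mem_span_pair]
  constructor
  · rintro ⟨b, c, hbc⟩
    have h0 : (a - b) • p + s (z - c • y) = 0 := by
      rw [map_sub, map_smul, sub_smul]
      linear_combination -hbc
    exact ⟨c, (sub_eq_zero.1 (h.eq_zero _ _ h0).2).symm⟩
  · rintro ⟨c, rfl⟩
    exact ⟨a, c, by rw [map_smul]⟩

theorem forall_polar_eq_zero_iff (h : IsEckardtSplitting F p s)
    (hG : ∀ x y z, polar G x y z = polar F (s x) (s y) (s z)) {y : κ → ℂ} {v : ι → ℂ} :
    (∀ u ∈ Submodule.span ℂ {p, s y}, polar F u u v = 0) ↔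
      ∃ (a : ℂ) (z : κ → ℂ), v = a • p + s z ∧ polar G y y z = 0 := by
  constructor
  · intro hv
    obtain ⟨a, z, rfl⟩ := h.exists_eq v (hv p (Submodule.subset_span (by simp)))
    refine ⟨a, z, rfl, ?_⟩
    have := hv (s y) (Submodule.subset_span (by simp))
    have h2 := h.polar_combination hG 0 0 a y y z
    rwa [zero_smul, zero_add, this, eq_comm] at h2
  · rintro ⟨a, z, rfl, hz⟩ u hu
    obtain ⟨b, c, rfl⟩ := Submodule.mem_span_pair.1 hu
    rw [← map_smul, h.polar_combination hG]
    simp [hz]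

theorem isDegenerateAlong_iff (h : IsEckardtSplitting F p s)
    (hG : ∀ x y z, polar G x y z = polar F (s x) (s y) (s z)) {y : κ → ℂ}
    (hy : polar G y y ≠ 0) :
    IsDegenerateAlong F (Submodule.span ℂ {p, s y}) ↔ ∃ r ≠ 0, ∀ z, polar G y r z = 0 := by
  constructor
  · rintro ⟨r, hrL, hr, hd⟩
    obtain ⟨a, r, rfl, hr0⟩ := (h.forall_polar_eq_zero_iff hG).1 hr
    obtain ⟨e, he⟩ := exists_apply_eq_one hy
    rw [h.mem_span_pair_iff] at hrL
    -- With Φ_G(y,y,e) = 1, every z is a multiple of e plus a vector tangent to Y at y. Subtracting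
    -- this multiple of y makes the form vanish on e while keeping it zero on tangent vectors.
    refine ⟨r - polar G y r e • y, fun h0 => hrL ⟨_, (sub_eq_zero.1 h0).symm⟩, fun z => ?_⟩
    have hz := hd (0 • p + s (z - polar G y y z • e))
      ((h.forall_polar_eq_zero_iff hG).2 ⟨_, _, rfl, by
        rw [map_sub, map_smul, he, smul_eq_mul, mul_one, sub_self]⟩)
      ((0 : ℂ) • p + s y) (Submodule.mem_span_pair.2 ⟨0, 1, by simp⟩)
    rw [h.polar_combination hG, map_sub, map_smul, smul_eq_mul] at hz
    rw [map_sub, map_smul, LinearMap.sub_apply, LinearMap.smul_apply, smul_eq_mul]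
    linear_combination hz
  · rintro ⟨r, hr0, hr⟩
    have hyr : polar G y y r = 0 := by rw [polar_swap_right, hr]
    refine ⟨(0 : ℂ) • p + s r, fun hL => ?_,
      (h.forall_polar_eq_zero_iff hG).2 ⟨_, _, rfl, hyr⟩, fun v hv u hu => ?_⟩
    · obtain ⟨c, rfl⟩ := h.mem_span_pair_iff.1 hL
      refine hy (LinearMap.ext fun z => ?_)
      have := hr z
      rw [map_smul, LinearMap.smul_apply, smul_eq_mul] at this
      exact (mul_eq_zero.1 this).resolve_left fun hc => hr0 (by rw [hc, zero_smul])
    · obtain ⟨a, z, rfl, hz⟩ := (h.forall_polar_eq_zero_iff hG).1 hv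
      obtain ⟨b, c, rfl⟩ := Submodule.mem_span_pair.1 hu
      rw [← map_smul, h.polar_combination hG, map_smul, LinearMap.smul_apply,
        LinearMap.smul_apply, hr, smul_zero]

omit [Fintype κ] in
theorem linearIndependent_pair (h : IsEckardtSplitting F p s) {y : κ → ℂ} (hy : y ≠ 0) :
    LinearIndependent ℂ ![p, s y] := by
  rw [LinearIndependent.pair_iff]
  intro a c hac
  rw [← map_smul] at hac
  exact ⟨(h.eq_zero _ _ hac).1, (smul_eq_zero.1 (h.eq_zero _ _ hac).2).resolve_right hy⟩

omit [Fintype κ] in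
theorem finrank_span_pair (h : IsEckardtSplitting F p s) {y : κ → ℂ} (hy : y ≠ 0) :
    finrank ℂ (Submodule.span ℂ {p, s y}) = 2 := by
  have := finrank_span_eq_card (h.linearIndependent_pair hy)
  rwa [Matrix.range_cons, Matrix.range_cons, Matrix.range_empty, Set.union_empty] at this

/-- A line of X through p lies in the tangent space at p, so its second generator can be moved along
p into the image of s. -/
theorem exists_eq_span_of_isLineIn (h : IsEckardtSplitting F p s) (hF : F.IsHomogeneous 3)
    (hG : ∀ x y z, polar G x y z = polar F (s x) (s y) (s z)) {L : Submodule ℂ (ι → ℂ)}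
    (hL : IsLineIn F L) (hp : p ∈ L) :
    ∃ y ≠ 0, polar G y y y = 0 ∧ L = Submodule.span ℂ {p, s y} := by
  have hcube : ∀ u ∈ L, polar F u u u = 0 := fun u hu => by rw [← eval_eq_polar hF, hL.2 u hu]
  obtain ⟨x, hx, hxp⟩ : ∃ x ∈ L, x ∉ Submodule.span ℂ {p} := by
    by_contra! hle
    have h1 := Submodule.finrank_mono (show L ≤ Submodule.span ℂ {p} from hle)
    have h2 := finrank_span_le_card (R := ℂ) ({p} : Set (ι → ℂ))
    rw [hL.1] at h1
    simp at h2
    omega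
  obtain ⟨a, y, rfl⟩ := h.exists_eq x (polar_eq_zero_of_forall_cube hcube hp hp hx)
  have hy : y ≠ 0 := by
    rintro rfl
    rw [map_zero, add_zero] at hxp
    exact hxp (Submodule.smul_mem _ _ (Submodule.mem_span_singleton_self p))
  have hsy : s y ∈ L := by
    have := L.sub_mem hx (L.smul_mem a hp)
    rwa [add_sub_cancel_left] at this
  refine ⟨y, hy, by rw [hG, hcube _ hsy], (Submodule.eq_of_le_of_finrank_eq ?_ ?_).symm⟩
  · rw [Submodule.span_le]
    rintro _ (rfl | rfl)
    exacts [hp, hsy]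
  · rw [hL.1, h.finrank_span_pair hy]

/-- The line is spanned anew by p and w = s(y) − cp, with c chosen so that Φ(p,w,·) = 0; this
diagonalizes the pair of squares x₀², x₁² and leaves Φ(p,p,·), Φ(w,w,·) as two independent linear
forms. -/
theorem isHigherTripleLine {m : ℕ} {F : MvPolynomial (Fin (m + 4 + 1)) ℂ}
    {p : Fin (m + 4 + 1) → ℂ} {s : (κ → ℂ) →ₗ[ℂ] Fin (m + 4 + 1) → ℂ}
    (h : IsEckardtSplitting F p s) (hF : F.IsHomogeneous 3)
    (hG : ∀ x y z, polar G x y z = polar F (s x) (s y) (s z)) {y : κ → ℂ} (hy0 : y ≠ 0)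
    (hy : polar G y y ≠ 0) (hyy : polar G y y y = 0)
    (hd : IsDegenerateAlong F (Submodule.span ℂ {p, s y})) :
    IsHigherTripleLine F (Submodule.span ℂ {p, s y}) := by
  obtain ⟨e, he⟩ := exists_apply_eq_one h.ne_zero
  set c := polar F p (s y) e with hc
  set w := (-c) • p + s y with hw
  have hwT : polar F p p w = 0 := by
    rw [hw, map_add, map_smul, h.self, h.map, smul_zero, add_zero]
  -- The Eckardt condition gives vanishing on T, and the choice of c gives it on e, which spans a
  -- complement of T.
  have hpw : ∀ v, polar F p w v = 0 := fun v => by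
    have h1 := h.orth w (v - polar F p p v • e) hwT (by
      rw [map_sub, map_smul, he, smul_eq_mul, mul_one, sub_self])
    have h2 : polar F p w e = 0 := by
      rw [hw, map_add, map_smul, LinearMap.add_apply, LinearMap.smul_apply, he, ← hc, smul_eq_mul]
      ring
    rwa [map_sub, map_smul, h2, smul_zero, sub_zero] at h1
  have hww : ∀ a z, polar F w w (a • p + s z) = polar G y y z := fun a z =>
    h.polar_combination hG _ _ _ _ _ _
  have hspan : Submodule.span ℂ {p, s y} = Submodule.span ℂ {p, w} := by
    refine le_antisymm ?_ ?_ <;> rw [Submodule.span_le] <;> rintro _ (rfl | rfl)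
    · exact Submodule.subset_span (by simp)
    · exact Submodule.mem_span_pair.2 ⟨c, 1, by rw [hw]; module⟩
    · exact Submodule.subset_span (by simp)
    · exact Submodule.mem_span_pair.2 ⟨-c, 1, by rw [hw]; module⟩
  have hlin : LinearIndependent ℂ ![p, w] := by
    rw [LinearIndependent.pair_iff]
    intro a b hab
    obtain ⟨h1, h2⟩ := h.eq_zero (a - b * c) (b • y) (by rw [← hab, hw, map_smul]; module)
    have hb := (smul_eq_zero.1 h2).resolve_right hy0
    exact ⟨by rwa [hb, zero_mul, sub_zero] at h1, hb⟩
  obtain ⟨z, hz⟩ := exists_apply_eq_one hy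
  have hwz : polar F w w (s z) = 1 := by
    have := hww 0 z
    rwa [zero_smul, zero_add, hz] at this
  set v₃ := (1 / 3 : ℂ) • s z with hv₃
  -- The vector e is corrected by s(z), on which Φ(p,p,·) vanishes, so as to be killed by Φ(w,w,·);
  -- the factor 1/3 matches the factor 3 in the normal form.
  set v₂ := (1 / 3 : ℂ) • (e - polar F w w e • s z) with hv₂
  let α := (3 : ℂ) • polar F p p
  let β := (3 : ℂ) • polar F w w
  have hαv₂ : α v₂ = 1 := by
    simp only [α, hv₂, LinearMap.smul_apply, map_smul, map_sub, he, h.map, smul_eq_mul]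
    norm_num
  have hβv₂ : β v₂ = 0 := by
    simp only [β, hv₂, LinearMap.smul_apply, map_smul, map_sub, hwz, smul_eq_mul]
    ring
  have hαv₃ : α v₃ = 0 := by
    simp only [α, hv₃, LinearMap.smul_apply, map_smul, h.map, smul_eq_mul]
    ring
  have hβv₃ : β v₃ = 1 := by
    simp only [β, hv₃, LinearMap.smul_apply, map_smul, hwz, smul_eq_mul]
    norm_num
  have hαp : α p = 0 := by simp [α, h.self]
  have hαw : α w = 0 := by simp [α, hwT]
  have hβp : β p = 0 := by
    have := hww 1 0
    rw [one_smul, map_zero, add_zero, map_zero] at this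
    simp [β, this]
  have hβw : β w = 0 := by
    have := hww (-c) y
    rw [← hw, hyy] at this
    simp [β, this]
  obtain ⟨E, hE0, hE1, hEα, hEβ⟩ := exists_basis_of_dual_pair (m := m)
    (by rw [finrank_fintype_fun_eq_card, Fintype.card_fin]) hαv₂ hβv₂ hαv₃ hβv₃ hαp hβp hαw hβw hlin
  have hP := finrank_ker_inf_ker hαv₂ hβv₂ hαv₃ hβv₃
  rw [finrank_fintype_fun_eq_card, Fintype.card_fin] at hP
  refine isHigherTripleLine_of_basis hF ⟨⟨h.finrank_span_pair hy0, fun x hx => ?_⟩,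
    LinearMap.ker α ⊓ LinearMap.ker β, by omega, ?_, fun x hx v hv => ?_⟩ hd E ?_ ?_ ?_ ?_
  · obtain ⟨a, b, rfl⟩ := Submodule.mem_span_pair.1 hx
    rw [eval_eq_polar hF, ← map_smul, h.polar_combination hG]
    simp [hyy]
  · rw [hspan, Submodule.span_le]
    rintro _ (rfl | rfl)
    exacts [⟨hαp, hβp⟩, ⟨hαw, hβw⟩]
  · rw [mem_tangentSpace hF]
    rw [hspan] at hx
    obtain ⟨a, b, rfl⟩ := Submodule.mem_span_pair.1 hx
    have h1 : polar F p p v = 0 := by simpa [α] using hv.1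
    have h2 : polar F w w v = 0 := by simpa [β] using hv.2
    simp only [map_add, map_smul, LinearMap.add_apply, LinearMap.smul_apply, smul_eq_mul, h1, h2,
      polar_swap_left F w p, hpw]
    ring
  · rw [hE0, hE1, hspan]
  · rw [hE0]
    exact hEα
  · rw [hE1]
    exact hEβ
  · rw [hE0, hE1]
    exact fun j => hpw _

end IsEckardtSplitting

/-- The Hessian matrix at y is six times the matrix of the bilinear form Φ_G(y,·,·). -/
theorem eval_hessianDet_eq_zero_iff [DecidableEq κ] {G : MvPolynomial κ ℂ}
    (hG : G.IsHomogeneous 3) (y : κ → ℂ) :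
    eval y (hessianDet G) = 0 ↔ ∃ r ≠ 0, ∀ z, polar G y r z = 0 := by
  have hM : eval y (hessianDet G) =
      (Matrix.of fun i j => eval y (pderiv i (pderiv j G))).det := by
    rw [hessianDet, RingHom.map_det]
    rfl
  have hmul : ∀ r i, (Matrix.of fun i j => eval y (pderiv i (pderiv j G))).mulVec r i =
      6 * polar G y r (Pi.single i 1) := fun r i => by
    rw [polar_swap_right]
    conv_rhs => rw [← Finset.univ_sum_single r]
    rw [map_sum, Finset.mul_sum]
    refine Finset.sum_congr rfl fun j _ => ?_
    rw [show (Pi.single j (r j) : κ → ℂ) = r j • Pi.single j 1 by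
      rw [← Pi.single_smul, smul_eq_mul, mul_one], map_smul, polar_single_single hG,
      smul_eq_mul]
    change eval y (pderiv i (pderiv j G)) * r j = _
    rw [pderiv_comm]
    ring
  rw [hM, ← Matrix.exists_mulVec_eq_zero_iff]
  refine exists_congr fun r => and_congr_right fun _ => ⟨fun h z => ?_, fun h => ?_⟩
  · rw [← Finset.univ_sum_single z, map_sum]
    refine Finset.sum_eq_zero fun i _ => ?_
    have hi := congrFun h i
    rw [hmul] at hi
    rw [show (Pi.single i (z i) : κ → ℂ) = z i • Pi.single i 1 by
      rw [← Pi.single_smul, smul_eq_mul, mul_one], map_smul,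
      (mul_eq_zero.1 hi).resolve_left (by norm_num), smul_zero]
  · ext i
    rw [hmul, h, mul_zero]
    rfl

/-! ### Plücker coordinates -/

/-- The linear map `v ↦ u ∧ v`. -/
def wedgeLeft (u : ι → ℂ) : (ι → ℂ) →ₗ[ℂ] ι × ι → ℂ where
  toFun v := wedge u v
  map_add' v w := by
    ext ij
    simp only [wedge, Pi.add_apply]
    ring
  map_smul' c v := by
    ext ij
    simp only [wedge, Pi.smul_apply, smul_eq_mul, RingHom.id_apply]
    ring

omit [Fintype ι] in
theorem exists_smul_eq_of_wedge_eq_zero {u v : ι → ℂ} (hu : u ≠ 0) (h : wedge u v = 0) :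
    ∃ c : ℂ, c • u = v := by
  obtain ⟨i, hi⟩ := Function.ne_iff.1 hu
  rw [Pi.zero_apply] at hi
  refine ⟨v i / u i, funext fun j => ?_⟩
  have := congrFun h (i, j)
  simp only [wedge, Pi.zero_apply] at this
  rw [Pi.smul_apply, smul_eq_mul]
  field_simp
  linear_combination -this

omit [Fintype ι] in
theorem span_wedge_span_pair (u v : ι → ℂ) :
    Submodule.span ℂ {ω | ∃ x ∈ Submodule.span ℂ {u, v}, ∃ y ∈ Submodule.span ℂ {u, v},
      ω = wedge x y} = Submodule.span ℂ {wedge u v} := by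
  refine le_antisymm ?_ ?_
  · rw [Submodule.span_le]
    rintro _ ⟨x, hx, y, hy, rfl⟩
    obtain ⟨a, b, rfl⟩ := Submodule.mem_span_pair.1 hx
    obtain ⟨c, d, rfl⟩ := Submodule.mem_span_pair.1 hy
    refine Submodule.mem_span_singleton.2 ⟨a * d - b * c, funext fun ij => ?_⟩
    simp only [wedge, Pi.add_apply, Pi.smul_apply, smul_eq_mul]
    ring
  · rw [Submodule.span_singleton_le_iff_mem]
    exact Submodule.subset_span ⟨u, Submodule.subset_span (by simp), v,
      Submodule.subset_span (by simp), rfl⟩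

omit [Fintype ι] in
theorem joinLine_eq (p : ℙ ℂ (ι → ℂ)) (b : κ → ι → ℂ) (q : ℙ ℂ (κ → ℂ)) :
    joinLine p b q = Submodule.span ℂ {p.rep, Fintype.linearCombination ℂ b q.rep} := by
  rw [joinLine, Projectivization.submodule_eq, Projectivization.submodule_eq, Submodule.map_span,
    Set.image_singleton, Submodule.span_insert]

omit [Fintype ι] in
theorem joinLine_mk (p : ℙ ℂ (ι → ℂ)) (b : κ → ι → ℂ) {y : κ → ℂ} (hy : y ≠ 0) :
    joinLine p b (Projectivization.mk ℂ y hy) =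
      Submodule.span ℂ {p.rep, Fintype.linearCombination ℂ b y} := by
  rw [joinLine, Projectivization.submodule_eq, Projectivization.submodule_mk, Submodule.map_span,
    Set.image_singleton, Submodule.span_insert]

/-! ### The lines through the Eckardt point and their Plücker points. -/

namespace IsEckardtSplitting

variable {F : MvPolynomial ι ℂ} {p : ℙ ℂ (ι → ℂ)} {b : κ → ι → ℂ} {G : MvPolynomial κ ℂ}

theorem joinLine_injective (h : IsEckardtSplitting F p.rep (Fintype.linearCombination ℂ b)) :
    Function.Injective (joinLine p b) := by
  intro q q' hqq
  rw [joinLine_eq, joinLine_eq] at hqq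
  have hm : (0 : ℂ) • p.rep + Fintype.linearCombination ℂ b q.rep ∈
      Submodule.span ℂ {p.rep, Fintype.linearCombination ℂ b q'.rep} := by
    rw [← hqq, zero_smul, zero_add]
    exact Submodule.subset_span (by simp)
  rw [← q.mk_rep, ← q'.mk_rep, Projectivization.mk_eq_mk_iff']
  exact h.mem_span_pair_iff.1 hm

/-- If p ∧ s(y) = 0, then s(y) is a multiple of p, which is outside the image of s unless y = 0. -/
theorem wedge_injective (h : IsEckardtSplitting F p.rep (Fintype.linearCombination ℂ b)) :
    Function.Injective (wedgeLeft p.rep ∘ₗ Fintype.linearCombination ℂ b) := by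
  rw [injective_iff_map_eq_zero]
  intro y hy
  obtain ⟨c, hc⟩ := exists_smul_eq_of_wedge_eq_zero p.rep_nonzero
    (show wedge p.rep (Fintype.linearCombination ℂ b y) = 0 from hy)
  refine (h.eq_zero (-c) y ?_).2
  rw [← hc, neg_smul, neg_add_cancel]

theorem isPluckerPoint_iff (h : IsEckardtSplitting F p.rep (Fintype.linearCombination ℂ b))
    (q : ℙ ℂ (κ → ℂ)) (z : ℙ ℂ (ι × ι → ℂ)) : IsPluckerPoint (joinLine p b q) z ↔
      z = Projectivization.map (wedgeLeft p.rep ∘ₗ Fintype.linearCombination ℂ b)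
        h.wedge_injective q := by
  rw [IsPluckerPoint, joinLine_eq, span_wedge_span_pair, ← Projectivization.submodule_injective.eq_iff,
    submodule_map, q.submodule_eq, Submodule.map_span, Set.image_singleton]
  rfl

theorem pluckerSet_eq_image (h : IsEckardtSplitting F p.rep (Fintype.linearCombination ℂ b))
    {Z : Set (ℙ ℂ (κ → ℂ))} {𝓛 : Set (Submodule ℂ (ι → ℂ))} (hZ : joinLine p b '' Z = 𝓛) :
    pluckerSet 𝓛 = Projectivization.map (wedgeLeft p.rep ∘ₗ Fintype.linearCombination ℂ b)
        h.wedge_injective '' Z := by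
  subst hZ
  ext z
  constructor
  · rintro ⟨_, ⟨q, hq, rfl⟩, hz⟩
    exact ⟨q, hq, ((h.isPluckerPoint_iff q z).1 hz).symm⟩
  · rintro ⟨q, hq, rfl⟩
    exact ⟨_, ⟨q, hq, rfl⟩, (h.isPluckerPoint_iff q _).2 rfl⟩

theorem mem_cone_iff (h : IsEckardtSplitting F p.rep (Fintype.linearCombination ℂ b))
    (hF : F.IsHomogeneous 3) (hGh : G.IsHomogeneous 3)
    (hG : ∀ x y z, polar G x y z = polar F (Fintype.linearCombination ℂ b x)
      (Fintype.linearCombination ℂ b y) (Fintype.linearCombination ℂ b z))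
    (hne : (hypersurface G).Nonempty) (x : ℙ ℂ (ι → ℂ)) :
    (x ∈ hypersurface F ∧ x.submodule ≤ tangentSpace F p.rep) ↔
      ∃ q ∈ hypersurface G, x.submodule ≤ joinLine p b q := by
  simp only [Projectivization.submodule_eq x, Submodule.span_singleton_le_iff_mem,
    mem_tangentSpace hF]
  constructor
  · rintro ⟨hx, hxT⟩
    obtain ⟨a, y, hxy⟩ := h.exists_eq _ hxT
    -- Here x is the vertex p, which lies on every line of the cone; a point of Y is needed for
    -- there to be one.
    by_cases hy : y = 0
    · obtain ⟨q, hq⟩ := hne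
      refine ⟨q, hq, ?_⟩
      rw [joinLine_eq, hxy, hy, map_zero, add_zero]
      exact Submodule.smul_mem _ _ (Submodule.subset_span (by simp))
    · refine ⟨Projectivization.mk ℂ y hy, (eval_rep_mk_eq_zero_iff hGh hy).2 ?_, ?_⟩
      · rw [eval_eq_polar hGh, ← h.polar_combination hG a a a, ← hxy, ← eval_eq_polar hF]
        exact hx
      · rw [joinLine_mk, hxy]
        exact h.mem_span_pair_iff.2 ⟨1, one_smul _ _⟩
  · rintro ⟨q, hq, hx⟩
    rw [joinLine_eq] at hx
    obtain ⟨a, c, hac⟩ := Submodule.mem_span_pair.1 hx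
    constructor
    · change eval x.rep F = 0
      rw [eval_eq_polar hF, ← hac, ← map_smul, h.polar_combination hG, ← eval_eq_polar hGh,
        eval_smul_of_isHomogeneous hGh, show eval q.rep G = 0 from hq, mul_zero]
    · rw [← hac, map_add, map_smul, map_smul, h.self, h.map, smul_zero, smul_zero, add_zero]

theorem bijOn_joinLine [DecidableEq κ] {m : ℕ} {F : MvPolynomial (Fin (m + 4 + 1)) ℂ}
    {p : ℙ ℂ (Fin (m + 4 + 1) → ℂ)} {b : κ → Fin (m + 4 + 1) → ℂ}
    (h : IsEckardtSplitting F p.rep (Fintype.linearCombination ℂ b))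
    (hF : F.IsHomogeneous 3) (hGh : G.IsHomogeneous 3) (hGs : IsSmoothForm G)
    (hG : ∀ x y z, polar G x y z = polar F (Fintype.linearCombination ℂ b x)
      (Fintype.linearCombination ℂ b y) (Fintype.linearCombination ℂ b z)) :
    Set.BijOn (joinLine p b) (hypersurface G ∩ hypersurface (hessianDet G))
      (higherTripleLinesThrough F p) := by
  rw [isSmoothForm_iff hGh] at hGs
  refine ⟨fun q hq => ?_, h.joinLine_injective.injOn, fun L hL => ?_⟩
  · have hy : polar G q.rep q.rep ≠ 0 := fun h0 => q.rep_nonzero (hGs _ h0)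
    refine ⟨?_, le_sup_left⟩
    rw [joinLine_eq]
    refine h.isHigherTripleLine hF hG q.rep_nonzero hy ?_ ((h.isDegenerateAlong_iff hG hy).2 ?_)
    · rw [← eval_eq_polar hGh]
      exact hq.1
    · exact (eval_hessianDet_eq_zero_iff hGh _).1 hq.2
  · have hpL : p.rep ∈ L := hL.2 (by
      rw [p.submodule_eq]
      exact Submodule.mem_span_singleton_self _)
    obtain ⟨y, hy0, hyy, rfl⟩ := h.exists_eq_span_of_isLineIn hF hG hL.1.1.1 hpL
    have hy : polar G y y ≠ 0 := fun h0 => hy0 (hGs _ h0)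
    refine ⟨Projectivization.mk ℂ y hy0, ⟨?_, ?_⟩, joinLine_mk p b hy0⟩
    · exact (eval_rep_mk_eq_zero_iff hGh hy0).2 (by rw [eval_eq_polar hGh, hyy])
    · refine (eval_rep_mk_eq_zero_iff (isHomogeneous_hessianDet hGh) hy0).2 ?_
      rw [eval_hessianDet_eq_zero_iff hGh]
      exact (h.isDegenerateAlong_iff hG hy).1 (hL.1.isDegenerateAlong hF)

end IsEckardtSplitting

end CubicLines

end

theorem mainTheorem12 (n : ℕ) (hn : 4 ≤ n)
    -- the smooth cubic hypersurface `X` in `ℙⁿ`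
    (F : MvPolynomial (Fin (n + 1)) ℂ) (hF : F.IsHomogeneous 3) (hX : IsSmoothForm F)
    -- the Eckardt point
    (p : ℙ ℂ (Fin (n + 1) → ℂ)) (hp : IsEckardtPoint F p)
    -- a basis of a hyperplane of the tangent hyperplane at `p` that does not contain `p`
    (b : Fin (n - 1) → Fin (n + 1) → ℂ) (hb : LinearIndependent ℂ b)
    (hbT : ∀ k, b k ∈ tangentSpace F p.rep)
    (hbp : Disjoint p.submodule (Submodule.span ℂ (Set.range b)))
    -- the equation `G = 0` of `Y`, the section of `X` by that subspace
    (G : MvPolynomial (Fin (n - 1)) ℂ) (hG : G = pullback b F) :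
    -- `Y` is a smooth cubic, and `T_p X ∩ X` is the cone over `Y` with vertex `p`
    (G.IsHomogeneous 3 ∧ IsSmoothForm G ∧
      ∀ x : ℙ ℂ (Fin (n + 1) → ℂ),
        (x ∈ hypersurface F ∧ x.submodule ≤ tangentSpace F p.rep) ↔
          ∃ q ∈ hypersurface G, x.submodule ≤ joinLine p b q) ∧
    -- `q ↦ line pq` is a bijection from `Y ∩ Hess(Y)` to the higher triple lines through `p`
    Set.BijOn (joinLine p b) (hypersurface G ∩ hypersurface (hessianDet G))
      (higherTripleLinesThrough F p) ∧
    -- and an isomorphism onto this set of lines, as a subset of the Grassmannian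
    (∃ φ : ↥(hypersurface G ∩ hypersurface (hessianDet G)) ≃
        ↥(pluckerSet (higherTripleLinesThrough F p)),
      (∀ q, IsPluckerPoint (joinLine p b q.1) (φ q).1) ∧
        IsRegularMap φ ∧ IsRegularMap φ.symm) ∧
    -- the family of higher triple lines through `p` has dimension `n - 4`
    HasProjDim (pluckerSet (higherTripleLinesThrough F p)) (n - 4) := by
  obtain ⟨m, rfl⟩ : ∃ m, n = m + 4 := ⟨n - 4, by omega⟩
  have h : IsEckardtSplitting F p.rep (Fintype.linearCombination ℂ b) :=
    isEckardtSplitting hF hX hp hb hbT hbp (by simp only [Fintype.card_fin]; omega)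
  have hGh : G.IsHomogeneous 3 := hG ▸ isHomogeneous_pullback b hF
  have hGp : ∀ x y z, polar G x y z = polar F (Fintype.linearCombination ℂ b x)
      (Fintype.linearCombination ℂ b y) (Fintype.linearCombination ℂ b z) := fun x y z => by
    rw [hG, polar_pullback b hF]
    rfl
  have hGs : IsSmoothForm G := h.isSmoothForm hF hX hGh hGp
  have hne : (hypersurface G).Nonempty := by
    have hG0 : eval 0 G = 0 := by simpa using eval_smul_of_isHomogeneous hGh 0 0
    -- The pair of equations is G taken twice, in m + 3 variables.
    obtain ⟨x, hx, hxG, -⟩ := exists_common_zero hG0 hG0 (by simp only [Fintype.card_fin]; omega)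
    exact ⟨_, (eval_rep_mk_eq_zero_iff hGh hx).2 hxG⟩
  have hbij := h.bijOn_joinLine hF hGh hGs hGp
  refine ⟨⟨hGh, hGs, h.mem_cone_iff hF hGh hGp hne⟩, hbij, ?_⟩
  rw [h.pluckerSet_eq_image hbij.image_eq]
  refine ⟨?_, HasProjDim.map (hasProjDim_inter_hessianDet hGh hGs ?_) _ _⟩
  · obtain ⟨φ, hφ, h1, h2⟩ := exists_equiv_isRegularMap _ h.wedge_injective
      (hypersurface G ∩ hypersurface (hessianDet G))
    exact ⟨φ, fun q => (h.isPluckerPoint_iff _ _).2 (hφ q), h1, h2⟩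
  · simp only [Fintype.card_fin]
    omega
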